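/- For $n\ge 0$ let $[2n]=\{1,\dots,2n\}$. A matching of size $n$ is a fixed-point free involution $\mathfrak m$ of $[2n]$; its chords are the $n$ pairs $\{i,\mathfrak m(i)\}$. Put $\omega_n=e^{2\mathbf i\pi/(2n)}$ and draw each chord $\{i,\mathfrak m(i)\}$ as the straight segment joining $\omega_n^{\,i}$ and $\omega_n^{\,\mathfrak m(i)}$ in the unit disk. The graph $G_{\mathfrak m}$ has the chords of $\mathfrak m$ as vertices, and two distinct chords are adjacent if and only if their segments intersect. A matching $\mathfrak m$ represents a graph $G$ if $G$ is isomorphic to $G_{\mathfrak m}$, and $G$ is a circle graph if it is represented by some matching. A matching $\mathfrak m$ of size $n$ is $k$-decomposable if there is a partition of $[2n]$ into four (possibly empty) parts $C_1,C_2,C_3,C_4$ such that: each $C_i$ is a circular interval, i.e. a (possibly empty) set of consecutive elements of $[2n]$ modulo $2n$; $1\in C_1$, and the nonempty parts among $C_2,C_3,C_4$ are ordered according to their smallest element; every chord of $\mathfrak m$ has either both extremities in $C_1\cup C_3$ or both extremities in $C_2\cup C_4$; and $C_2\cup C_4$ contains exactly $k$ chords. It is decomposable if it is $k$-decomposable for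 some $k$ with $2\le k\le n-2$, and indecomposable otherwise. A split of a graph is a partition of its vertex set into two nonempty sides $V_1,V_2$ for which there are (possibly empty) subsets $A\subseteq V_1$ and $B\subseteq V_2$ such that the edges between $V_1$ and $V_2$ are exactly all pairs $\{a,b\}$ with $a\in A$, $b\in B$. A split is trivial if one of its sides has exactly one vertex. A graph is split-prime if it has no nontrivial split. **Proposition.** Let $G$ be a circle graph and let $\mathfrak m$ be a matching that represents $G$. Then $G$ is split-prime if and only if $\mathfrak m$ is indecomposable. -/

import Mathlib

/-- The intersection graph of a family of sets: two distinct indices are adjacent if and only if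
the corresponding sets meet. -/
def intersectionGraph {ι X : Type*} (s : ι → Set X) : SimpleGraph ι where
  Adj i j := i ≠ j ∧ (s i ∩ s j).Nonempty
  symm := ⟨fun _ _ h => ⟨h.1.symm, by rw [Set.inter_comm]; exact h.2⟩⟩
  loopless := ⟨fun _ h => h.1 rfl⟩

/-- A matching of size `n`: a fixed-point free involution of `[2n] = {1, …, 2n}`.
The element `i : Fin (2 * n)` stands for the label `i + 1`. -/
structure Matching (n : ℕ) where
  /-- the involution -/
  toFun : Fin (2 * n) → Fin (2 * n)
  involutive : Function.Involutive toFun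
  fixedPointFree : ∀ i, toFun i ≠ i

namespace Matching

variable {n : ℕ}

/-- The chords of a matching: the pairs `{i, m(i)}`. -/
def chords (m : Matching n) : Finset (Finset (Fin (2 * n))) :=
  Finset.univ.image fun i => {i, m.toFun i}

/-- The point `ω_n ^ i` of the unit circle, `ω_n = exp(2πi / (2n))`, that carries a label `i`
of `[2n]`. -/
noncomputable def circlePoint (n : ℕ) (i : Fin (2 * n)) : ℂ :=
  Complex.exp (2 * Complex.I * Real.pi / (2 * n)) ^ ((i : ℕ) + 1)

/-- The straight chord of the unit circle (a segment of `ℂ`) drawn for a pair of labels: the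
convex hull of its two endpoints. -/
noncomputable def chordSegment (n : ℕ) (c : Finset (Fin (2 * n))) : Set ℂ :=
  convexHull ℝ (circlePoint n '' (c : Set (Fin (2 * n))))

/-- The graph `G_m`: the intersection graph of the circular representation of `m`.
Its vertices are the chords of `m`. -/
noncomputable def graph (m : Matching n) : SimpleGraph {c // c ∈ m.chords} :=
  intersectionGraph fun c => chordSegment n c.1

/-- `m` represents the (unlabeled) graph `G`. -/
def Represents {V : Type*} (m : Matching n) (G : SimpleGraph V) : Prop :=
  Nonempty (G ≃g m.graph)

/-- A circular interval of `Fin N`: for some start `a` and length `l`, the set of the residues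
of `a, a + 1, …, a + l - 1` modulo `N` (it is empty if `l = 0`). -/
def IsCircularInterval {N : ℕ} (C : Finset (Fin N)) : Prop :=
  ∃ a l : ℕ, ∀ x : Fin N, x ∈ C ↔ ∃ j < l, (x : ℕ) = (a + j) % N

/-- `m` is `k`-decomposable. The parts `C 0, C 1, C 2, C 3` are `C₁, C₂, C₃, C₄`; the
label `1` is the element of `Fin (2 * n)` of value `0`. -/
def IsKDecomposable (m : Matching n) (k : ℕ) : Prop :=
  ∃ C : Fin 4 → Finset (Fin (2 * n)),
    (∀ x, ∃! i, x ∈ C i) ∧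
    (∀ i, IsCircularInterval (C i)) ∧
    (∃ x ∈ C 0, (x : ℕ) = 0) ∧
    (∀ i j, 0 < i → i < j → ∀ (hi : (C i).Nonempty) (hj : (C j).Nonempty),
      (C i).min' hi < (C j).min' hj) ∧
    (∀ c ∈ m.chords, c ⊆ C 0 ∪ C 2 ∨ c ⊆ C 1 ∪ C 3) ∧
    (m.chords.filter fun c => c ⊆ C 1 ∪ C 3).card = k

/-- `m` is decomposable: `k`-decomposable for some `k` with `2 ≤ k ≤ n - 2`. -/
def IsDecomposable (m : Matching n) : Prop :=
  ∃ k, 2 ≤ k ∧ k + 2 ≤ n ∧ m.IsKDecomposable k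

/-- `m` is indecomposable. -/
def IsIndecomposable (m : Matching n) : Prop :=
  ¬ m.IsDecomposable

end Matching

/-- A circle graph: a graph represented by some matching. -/
def IsCircleGraph {V : Type*} (G : SimpleGraph V) : Prop :=
  ∃ (n : ℕ) (m : Matching n), m.Represents G

namespace SimpleGraph

variable {V : Type*}

/-- A cut: a partition of the vertex set into two nonempty sides. (It does not depend on the
edges.) -/
def IsVertexCut (_G : SimpleGraph V) (V₁ V₂ : Set V) : Prop :=
  V₁.Nonempty ∧ V₂.Nonempty ∧ Disjoint V₁ V₂ ∧ V₁ ∪ V₂ = Set.univ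

/-- A split: a cut whose cut-set is a (possibly empty) complete bipartite graph, that is, the
edges between the two sides are exactly those between `A` and `B`, for some subsets `A` and `B`
of the two sides. -/
def IsSplit (G : SimpleGraph V) (V₁ V₂ : Set V) : Prop :=
  G.IsVertexCut V₁ V₂ ∧
    ∃ A ⊆ V₁, ∃ B ⊆ V₂, ∀ x ∈ V₁, ∀ y ∈ V₂, G.Adj x y ↔ x ∈ A ∧ y ∈ B

/-- A graph is split-prime if every split is trivial: one of its sides has only one vertex. -/
def IsSplitPrime (G : SimpleGraph V) : Prop :=
  ∀ V₁ V₂ : Set V, G.IsSplit V₁ V₂ → V₁.encard = 1 ∨ V₂.encard = 1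

end SimpleGraph

/-! Two chords meet exactly when their endpoints interleave (`graph_adj_iff`), so everything reduces
to the cyclic order of the positions.

A decomposition gives a split: between a chord inside `C 0 ∪ C 2` and one inside `C 1 ∪ C 3`, a
crossing occurs exactly when the first joins `C 0` to `C 2` and the second joins `C 1` to `C 3`
(`IsDecomposable.exists_isSplit`).

Conversely, a nontrivial split colours the positions by a rank-one union of chords `S`. The goal is
a possibly different union of chords, with two chords inside and two outside, whose membership
changes at most four times around the circle. The induction (`isBlockDecomposable_of_isRankOne`) is
on the number of colour changes of `S`. If some chord crosses nothing of the other colour but has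
that colour on both sides, cutting along it gives a rank-one set with fewer changes, or else a
decomposition outright (`isBlockDecomposable_or_exists_smaller`).

If there is no such chord, consider the monochromatic blocks. A chord joining different blocks
crosses the other colour, hence by rank one crosses every chord of that colour that crosses back.
This forces all chords leaving a given block to end in one common block (`blockIndex_toFun_eq`), so
two paired blocks form a union of chords with at most four changes. This is a decomposition unless
every block is a single position. In that last case the colours alternate and chords of different
colours always cross, and the chords at positions 0 and 1 turn out to end at adjacent positions, so
together they form two intervals (`isBlockDecomposable_of_alternating`). -/

/-- `x` lies strictly between `a` and `b`. -/
def StrictlyBetween (a b x : ℕ) : Prop := (a < x ∧ x < b) ∨ (b < x ∧ x < a)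

theorem strictlyBetween_comm (a b x : ℕ) : StrictlyBetween a b x ↔ StrictlyBetween b a x :=
  or_comm

theorem ncard_pair_le {X : Type*} (a b : X) : ({a, b} : Set X).ncard ≤ 2 :=
  (Set.ncard_insert_le _ _).trans (by rw [Set.ncard_singleton])

/-! ### Interleaving chords and unions of chords. -/

namespace Matching

section Crossing

variable {n : ℕ} (m : Matching n)

/-- The chords at the positions `x` and `y` interleave. -/
def Crosses (x y : Fin (2 * n)) : Prop :=
  ¬ (StrictlyBetween x (m.toFun x) y ↔ StrictlyBetween x (m.toFun x) (m.toFun y))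

/-- A set of positions that is a union of chords. -/
def IsInvariant (S : Set (Fin (2 * n))) : Prop := ∀ x, m.toFun x ∈ S ↔ x ∈ S

/-- The set contains endpoints of two distinct chords. -/
def HasTwoChords (S : Set (Fin (2 * n))) : Prop := ∃ x ∈ S, ∃ y ∈ S, y ≠ x ∧ y ≠ m.toFun x

/-- The crossings between the chords of `S` and the other chords form a complete bipartite graph. -/
def IsRankOne (S : Set (Fin (2 * n))) : Prop :=
  ∀ x ∈ S, ∀ x' ∈ S, ∀ y ∉ S, ∀ y' ∉ S, m.Crosses x y → m.Crosses x' y' → m.Crosses x y'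

@[simp] theorem toFun_toFun (x : Fin (2 * n)) : m.toFun (m.toFun x) = x := m.involutive x

theorem toFun_val_ne (x : Fin (2 * n)) : (m.toFun x : ℕ) ≠ x :=
  fun h => m.fixedPointFree x (Fin.ext h)

theorem toFun_eq_iff (x y : Fin (2 * n)) : m.toFun x = y ↔ x = m.toFun y :=
  m.involutive.eq_iff

theorem crosses_toFun_left (x y : Fin (2 * n)) : m.Crosses (m.toFun x) y ↔ m.Crosses x y := by
  unfold Crosses
  rw [toFun_toFun, strictlyBetween_comm (m.toFun x), strictlyBetween_comm (m.toFun x)]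

theorem crosses_toFun_right (x y : Fin (2 * n)) : m.Crosses x (m.toFun y) ↔ m.Crosses x y := by
  unfold Crosses
  rw [toFun_toFun]
  tauto

theorem not_crosses_self (x : Fin (2 * n)) : ¬ m.Crosses x x := by
  unfold Crosses StrictlyBetween
  omega

theorem Crosses.ne {m : Matching n} {x y : Fin (2 * n)} (h : m.Crosses x y) :
    y ≠ x ∧ y ≠ m.toFun x := by
  refine ⟨?_, ?_⟩
  · rintro rfl
    exact m.not_crosses_self _ h
  · rintro rfl
    exact m.not_crosses_self _ ((m.crosses_toFun_right _ _).1 h)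

theorem val_ne_of_ne {x y : Fin (2 * n)} (h : y ≠ x) (h' : y ≠ m.toFun x) :
    (y : ℕ) ≠ x ∧ (y : ℕ) ≠ m.toFun x ∧ (m.toFun y : ℕ) ≠ x ∧ (m.toFun y : ℕ) ≠ m.toFun x := by
  refine ⟨fun e => h (Fin.ext e), fun e => h' (Fin.ext e), fun e => h' ?_, fun e => h ?_⟩
  · exact (m.toFun_eq_iff _ _).1 (Fin.ext e)
  · exact m.involutive.injective (Fin.ext e)

theorem Crosses.symm {m : Matching n} {x y : Fin (2 * n)} (h : m.Crosses x y) :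
    m.Crosses y x := by
  have h1 := m.val_ne_of_ne h.ne.1 h.ne.2
  unfold Crosses StrictlyBetween at *
  omega

variable {m} {S : Set (Fin (2 * n))}

theorem IsInvariant.compl (h : m.IsInvariant S) : m.IsInvariant Sᶜ := fun x => not_congr (h x)

theorem IsInvariant.union {S' : Set (Fin (2 * n))} (h : m.IsInvariant S) (h' : m.IsInvariant S') :
    m.IsInvariant (S ∪ S') := fun x => or_congr (h x) (h' x)

theorem isInvariant_pair (x : Fin (2 * n)) : m.IsInvariant {x, m.toFun x} := by
  intro y
  simp only [Set.mem_insert_iff, Set.mem_singleton_iff, m.toFun_eq_iff y, toFun_toFun]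
  exact or_comm

theorem IsInvariant.of_mem (h : ∀ x ∈ S, m.toFun x ∈ S) : m.IsInvariant S :=
  fun x => ⟨fun hx => by simpa using h _ hx, h x⟩

theorem IsRankOne.compl (h : m.IsRankOne S) : m.IsRankOne Sᶜ := by
  intro y hy y' hy' x hx x' hx' h1 h2
  exact (h x' (not_not.1 hx') x (not_not.1 hx) y' hy' y hy h2.symm h1.symm).symm

theorem eq_pair_of_not_hasTwoChords (hS : m.IsInvariant S) (h : ¬ m.HasTwoChords S)
    {x : Fin (2 * n)} (hx : x ∈ S) : S = {x, m.toFun x} := by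
  ext y
  simp only [Set.mem_insert_iff, Set.mem_singleton_iff]
  constructor
  · intro hy
    by_contra hc
    push Not at hc
    exact h ⟨x, hx, y, hy, hc.1, hc.2⟩
  · rintro (rfl | rfl)
    · exact hx
    · exact (hS _).2 hx

theorem HasTwoChords.mono {S' : Set (Fin (2 * n))} (h : m.HasTwoChords S) (hS : S ⊆ S') :
    m.HasTwoChords S' := by
  obtain ⟨x, hx, y, hy, h⟩ := h
  exact ⟨x, hS hx, y, hS hy, h⟩

theorem HasTwoChords.nonempty (h : m.HasTwoChords S) : S.Nonempty := by
  obtain ⟨x, hx, -⟩ := h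
  exact ⟨x, hx⟩

theorem four_le_of_hasTwoChords (hS : m.IsInvariant S) (h : m.HasTwoChords S)
    (h' : m.HasTwoChords Sᶜ) : 4 ≤ n := by
  have key : ∀ {S : Set (Fin (2 * n))}, m.IsInvariant S → m.HasTwoChords S → 4 ≤ S.ncard := by
    rintro S hS ⟨x, hx, y, hy, h1, h2⟩
    have hsub : (({x, m.toFun x, y, m.toFun y} : Finset (Fin (2 * n))) : Set (Fin (2 * n))) ⊆ S := by
      intro z hz
      simp only [Finset.coe_insert, Finset.coe_singleton, Set.mem_insert_iff,
        Set.mem_singleton_iff] at hz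
      rcases hz with rfl | rfl | rfl | rfl
      exacts [hx, (hS _).2 hx, hy, (hS _).2 hy]
    have hv := m.val_ne_of_ne h1 h2
    have hc : ({x, m.toFun x, y, m.toFun y} : Finset (Fin (2 * n))).card = 4 := by
      rw [Finset.card_eq_of_equiv_fin]
      have hx1 := m.toFun_val_ne x
      have hy1 := m.toFun_val_ne y
      refine Finset.equivFinOfCardEq ?_
      rw [Finset.card_insert_of_notMem, Finset.card_insert_of_notMem,
        Finset.card_insert_of_notMem, Finset.card_singleton] <;>
      simp only [Finset.mem_insert, Finset.mem_singleton, Fin.ext_iff] <;> omega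
    rw [← hc, ← Set.ncard_coe_finset]
    exact Set.ncard_le_ncard hsub (Set.toFinite _)
  have h1 := key hS h
  have h2 := key hS.compl h'
  have h3 := Set.ncard_add_ncard_compl S
  rw [Nat.card_eq_fintype_card, Fintype.card_fin] at h3
  omega

theorem ncard_le_two_of_subset_val {B : Set (Fin (2 * n))} (u v : ℕ)
    (h : ∀ x ∈ B, (x : ℕ) = u ∨ (x : ℕ) = v) : B.ncard ≤ 2 := by
  rw [← Set.ncard_image_of_injective B Fin.val_injective]
  refine (Set.ncard_le_ncard (t := {u, v}) ?_ (Set.toFinite _)).trans (ncard_pair_le u v)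
  rintro _ ⟨x, hx, rfl⟩
  exact h x hx

end Crossing

/-! ### Cyclic boundaries, and decompositions from an invariant interval. -/

section Boundary

variable {n : ℕ} [NeZero n]

/-- The positions where membership in `S` changes, cyclically. -/
def boundary (S : Set (Fin (2 * n))) : Set (Fin (2 * n)) := {x | ¬ (x ∈ S ↔ x + 1 ∈ S)}

/-- There is a union of chords, nontrivial and with nontrivial complement, that consists of at most
two circular intervals. -/
def IsBlockDecomposable (m : Matching n) : Prop :=
  ∃ S, m.IsInvariant S ∧ m.HasTwoChords S ∧ m.HasTwoChords Sᶜ ∧ (boundary S).ncard ≤ 4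

theorem val_add_one_cases (x : Fin (2 * n)) :
    ((x : ℕ) + 1 < 2 * n ∧ ((x + 1 : Fin (2 * n)) : ℕ) = x + 1) ∨
      ((x : ℕ) + 1 = 2 * n ∧ ((x + 1 : Fin (2 * n)) : ℕ) = 0) := by
  have hn := NeZero.pos n
  have h1 : ((1 : Fin (2 * n)) : ℕ) = 1 := by
    rw [Fin.val_one', Nat.mod_eq_of_lt (by omega)]
  have h := Fin.val_add_eq_ite x 1
  rw [h1] at h
  have := x.isLt
  split_ifs at h <;> omega

theorem val_zero_eq : ((0 : Fin (2 * n)) : ℕ) = 0 := rfl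

theorem boundary_compl (S : Set (Fin (2 * n))) : boundary Sᶜ = boundary S := by
  ext x
  simp only [boundary, Set.mem_ofPred_eq, Set.mem_compl_iff]
  tauto

theorem boundary_union_subset (S S' : Set (Fin (2 * n))) :
    boundary (S ∪ S') ⊆ boundary S ∪ boundary S' := by
  intro x
  simp only [boundary, Set.mem_ofPred_eq, Set.mem_union]
  tauto

theorem ncard_boundary_union_le (S S' : Set (Fin (2 * n))) :
    (boundary (S ∪ S')).ncard ≤ (boundary S).ncard + (boundary S').ncard :=
  (Set.ncard_le_ncard (boundary_union_subset S S') (Set.toFinite _)).trans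
    (Set.ncard_union_le _ _)

theorem ncard_boundary_interval_le (a b : ℕ) :
    (boundary {x : Fin (2 * n) | a ≤ (x : ℕ) ∧ (x : ℕ) < b}).ncard ≤ 2 := by
  rcases le_or_gt b a with hab | hab
  · have : {x : Fin (2 * n) | a ≤ (x : ℕ) ∧ (x : ℕ) < b} = ∅ := by
      ext x
      simp only [Set.mem_ofPred_eq, Set.mem_empty_iff_false, iff_false]
      omega
    rw [this]
    simp [boundary]
  by_cases ha : a = 0
  · refine ncard_le_two_of_subset_val (b - 1) (2 * n - 1) fun x hx => ?_
    simp only [boundary, Set.mem_ofPred_eq] at hx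
    rcases val_add_one_cases x with h | h <;> omega
  by_cases hb : b < 2 * n
  · refine ncard_le_two_of_subset_val (a - 1) (b - 1) fun x hx => ?_
    simp only [boundary, Set.mem_ofPred_eq] at hx
    rcases val_add_one_cases x with h | h <;> omega
  · refine ncard_le_two_of_subset_val (a - 1) (2 * n - 1) fun x hx => ?_
    simp only [boundary, Set.mem_ofPred_eq] at hx
    rcases val_add_one_cases x with h | h <;> omega

theorem ncard_boundary_strictlyBetween_le (a b : ℕ) :
    (boundary {x : Fin (2 * n) | StrictlyBetween a b x}).ncard ≤ 2 := by
  rcases le_total a b with h | h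
  · have : {x : Fin (2 * n) | StrictlyBetween a b x} = {x : Fin (2 * n) | a + 1 ≤ (x : ℕ) ∧ (x : ℕ) < b} := by
      ext x
      simp only [StrictlyBetween, Set.mem_ofPred_eq]
      omega
    rw [this]
    exact ncard_boundary_interval_le _ _
  · have : {x : Fin (2 * n) | StrictlyBetween a b x} = {x : Fin (2 * n) | b + 1 ≤ (x : ℕ) ∧ (x : ℕ) < a} := by
      ext x
      simp only [StrictlyBetween, Set.mem_ofPred_eq]
      omega
    rw [this]
    exact ncard_boundary_interval_le _ _

/-- Otherwise `S` is closed under `+ 1`, and steps of 1 from a single element reach every position.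
-/
theorem exists_mem_add_one_notMem {S : Set (Fin (2 * n))} (h : S.Nonempty) (h' : Sᶜ.Nonempty) :
    ∃ x ∈ S, x + 1 ∉ S := by
  by_contra hc
  push Not at hc
  obtain ⟨x, hx⟩ := h
  obtain ⟨y, hy⟩ := h'
  have key : ∀ k : ℕ, x + Fin.ofNat (2 * n) k ∈ S := by
    intro k
    induction k with
    | zero => simpa using hx
    | succ k ih =>
      have := hc _ ih
      have e : Fin.ofNat (2 * n) (k + 1) = Fin.ofNat (2 * n) k + 1 := by
        ext
        simp [Fin.val_add]
      rwa [add_assoc, ← e] at this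
  refine hy ?_
  have := key ((y - x : Fin (2 * n)) : ℕ)
  rwa [Fin.ofNat_val_eq_self, add_sub_cancel] at this

theorem ncard_boundary_singleton_le (c : Fin (2 * n)) :
    (boundary ({c} : Set (Fin (2 * n)))).ncard ≤ 2 := by
  have : ({c} : Set (Fin (2 * n))) = {x : Fin (2 * n) | (c : ℕ) ≤ (x : ℕ) ∧ (x : ℕ) < c + 1} := by
    ext x
    simp only [Set.mem_singleton_iff, Set.mem_ofPred_eq, Fin.ext_iff]
    omega
  rw [this]
  exact ncard_boundary_interval_le _ _

/-- Absorbing the next position removes `x` from the boundary, and only `x + 1` can enter it. -/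
theorem ncard_boundary_union_succ_le {S : Set (Fin (2 * n))} {x : Fin (2 * n)} (hx : x ∈ S)
    (hx' : x + 1 ∉ S) : (boundary (S ∪ {x + 1})).ncard ≤ (boundary S).ncard := by
  have hsub : boundary (S ∪ {x + 1}) ⊆ insert (x + 1) (boundary S \ {x}) := by
    intro y hy
    by_cases hyx : y = x + 1
    · exact Or.inl hyx
    · refine Or.inr ⟨?_, ?_⟩
      · simp only [boundary, Set.mem_ofPred_eq, Set.mem_union, Set.mem_singleton_iff,
          add_left_inj] at hy ⊢
        have : y = x → y ∈ S := fun h => h ▸ hx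
        have : y = x → y + 1 ∉ S := fun h => h ▸ hx'
        tauto
      · rintro rfl
        simp only [boundary, Set.mem_ofPred_eq, Set.mem_union, Set.mem_singleton_iff, hx,
          or_true, true_or, not_true_eq_false, iff_self] at hy
  have hxb : x ∈ boundary S := by
    simp only [boundary, Set.mem_ofPred_eq, hx, hx']
    tauto
  refine (Set.ncard_le_ncard hsub (Set.toFinite _)).trans ((Set.ncard_insert_le _ _).trans ?_)
  rw [Set.ncard_sdiff_singleton_add_one hxb (Set.toFinite _)]

/-- A proper union of chords that is a circular interval gives a decomposition. -/
theorem isBlockDecomposable_of_interval {m : Matching n} (hn : 4 ≤ n) {S : Set (Fin (2 * n))}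
    (hS : m.IsInvariant S) (h1 : S.Nonempty) (h2 : Sᶜ.Nonempty) (hb : (boundary S).ncard ≤ 2) :
    m.IsBlockDecomposable := by
  have single : ∀ {S : Set (Fin (2 * n))}, m.IsInvariant S → S.Nonempty → Sᶜ.Nonempty →
      (boundary S).ncard ≤ 2 → ¬ m.HasTwoChords S → m.IsBlockDecomposable := by
    intro S hS h1 h2 hb h
    -- Here `S` is a single chord. Adjoin the chord of the position `x + 1` that follows it: the
    -- near end costs no boundary, the far end at most 2. Since `2 * n ≥ 8`, two further chords
    -- remain outside.
    obtain ⟨x, hx, hx'⟩ := exists_mem_add_one_notMem h1 h2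
    have hSe := eq_pair_of_not_hasTwoChords hS h hx
    refine ⟨S ∪ {x + 1, m.toFun (x + 1)}, hS.union (isInvariant_pair _), ?_, ?_, ?_⟩
    · refine ⟨x, Or.inl hx, x + 1, Or.inr (Or.inl rfl), ?_, ?_⟩
      · intro h
        exact hx' (h.symm ▸ hx)
      · intro h
        exact hx' (h ▸ (hS x).2 hx)
    · have big : ∀ t : Finset (Fin (2 * n)), t.card < 8 → ∃ y, y ∉ t := by
        intro t ht
        by_contra hc
        push Not at hc
        have := Finset.eq_univ_iff_forall.2 hc
        rw [this, Finset.card_univ, Fintype.card_fin] at ht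
        omega
      obtain ⟨u, hu⟩ := big {x, m.toFun x, x + 1, m.toFun (x + 1)} (Finset.card_le_four.trans_lt (by norm_num))
      obtain ⟨v, hv⟩ := big {u, m.toFun u, x, m.toFun x, x + 1, m.toFun (x + 1)}
        (Finset.card_le_six.trans_lt (by norm_num))
      simp only [Finset.mem_insert, Finset.mem_singleton] at hu hv
      refine ⟨u, ?_, v, ?_, ?_⟩
      · rw [hSe]
        simp only [Set.mem_compl_iff, Set.mem_union, Set.mem_insert_iff, Set.mem_singleton_iff]
        tauto
      · rw [hSe]
        simp only [Set.mem_compl_iff, Set.mem_union, Set.mem_insert_iff, Set.mem_singleton_iff]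
        tauto
      · tauto
    · have e : S ∪ {x + 1, m.toFun (x + 1)} = (S ∪ {x + 1}) ∪ {m.toFun (x + 1)} := by
        rw [Set.union_assoc, Set.singleton_union]
      rw [e]
      have a1 := ncard_boundary_union_succ_le hx hx'
      have a2 := ncard_boundary_singleton_le (m.toFun (x + 1))
      have a3 := ncard_boundary_union_le (S ∪ {x + 1}) {m.toFun (x + 1)}
      omega
  by_cases hS1 : m.HasTwoChords S
  · by_cases hS2 : m.HasTwoChords Sᶜ
    · exact ⟨S, hS, hS1, hS2, by omega⟩
    · exact single hS.compl h2 (by simpa using h1) (by rwa [boundary_compl]) hS2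
  · exact single hS h1 h2 hb hS1

/-- A chord that crosses no other gives a decomposition. -/
theorem isBlockDecomposable_of_isolated {m : Matching n} (hn : 4 ≤ n) {p : Fin (2 * n)}
    (hp : ∀ y, ¬ m.Crosses p y) : m.IsBlockDecomposable := by
  have hinv : m.IsInvariant {x | StrictlyBetween p (m.toFun p) x} := fun x => by
    have := hp x
    unfold Crosses at this
    simp only [Set.mem_ofPred_eq]
    exact (not_not.1 this).symm
  by_cases h : {x : Fin (2 * n) | StrictlyBetween p (m.toFun p) x}.Nonempty
  · refine isBlockDecomposable_of_interval hn hinv h ⟨p, ?_⟩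
      (ncard_boundary_strictlyBetween_le _ _)
    simp only [Set.mem_compl_iff, Set.mem_ofPred_eq, StrictlyBetween]
    omega
  · rw [Set.not_nonempty_iff_eq_empty] at h
    refine isBlockDecomposable_of_interval hn (isInvariant_pair p) ⟨p, Or.inl rfl⟩ ?_ ?_
    · by_contra hc
      rw [Set.not_nonempty_iff_eq_empty, Set.compl_empty_iff] at hc
      have := congrArg Set.ncard hc
      rw [Set.ncard_univ, Nat.card_eq_fintype_card, Fintype.card_fin] at this
      have := ncard_pair_le p (m.toFun p)
      omega
    · have hne := m.toFun_val_ne p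
      have e : ({p, m.toFun p} : Set (Fin (2 * n))) =
          {x : Fin (2 * n) | min (p : ℕ) (m.toFun p) ≤ (x : ℕ) ∧ (x : ℕ) < max (p : ℕ) (m.toFun p) + 1} := by
        ext x
        have hx : x ∉ {x : Fin (2 * n) | StrictlyBetween p (m.toFun p) x} := by simp [h]
        simp only [Set.mem_ofPred_eq, StrictlyBetween] at hx
        simp only [Set.mem_insert_iff, Set.mem_singleton_iff, Set.mem_ofPred_eq, Fin.ext_iff]
        omega
      rw [e]
      exact ncard_boundary_interval_le _ _

end Boundary

end Matching

/-! ### Cutting along a chord that separates one colour class. -/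

theorem strictlyBetween_iff_of_nested {p p' q q' r r' y : ℕ}
    (hp : StrictlyBetween r r' p) (hp' : StrictlyBetween r r' p')
    (hq : ¬ StrictlyBetween r r' q) (hq' : ¬ StrictlyBetween r r' q') (h1 : q ≠ r) (h2 : q ≠ r')
    (h3 : q' ≠ r) (h4 : q' ≠ r') (hy : StrictlyBetween p p' y) :
    StrictlyBetween q q' y ↔ StrictlyBetween q q' r := by
  unfold StrictlyBetween at *
  have hy' : (r < y ∧ y < r') ∨ (r' < y ∧ y < r) := by omega
  clear hp hp' hy
  rcases hy' with h | h
  · have a1 : q < r ∨ r' < q := by omega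
    have a2 : q' < r ∨ r' < q' := by omega
    clear hq hq'
    omega
  · have a1 : q < r' ∨ r < q := by omega
    have a2 : q' < r' ∨ r < q' := by omega
    clear hq hq'
    omega

theorem StrictlyBetween.of_mem_interval {p p' r r' y : ℕ} (hp : StrictlyBetween r r' p)
    (hp' : StrictlyBetween r r' p') (h1 : min p p' ≤ y) (h2 : y < max p p' + 1) :
    StrictlyBetween r r' y := by
  unfold StrictlyBetween at *
  omega

theorem StrictlyBetween.trans {p p' r r' y : ℕ} (hp : StrictlyBetween r r' p)
    (hp' : StrictlyBetween r r' p') (h : StrictlyBetween p p' y) : StrictlyBetween r r' y := by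
  unfold StrictlyBetween at *
  omega

theorem or_not_iff_congr {A A' B B' R : Prop} (h : ¬ (A ↔ A') ↔ ¬ (B ↔ B'))
    (h1 : ¬ (A ∧ ¬ (B ↔ R))) (h2 : ¬ (A' ∧ ¬ (B' ↔ R))) :
    (A' ∨ ¬ (B' ↔ R)) ↔ (A ∨ ¬ (B ↔ R)) := by
  grind

namespace Matching

variable {n : ℕ} [NeZero n] {m : Matching n}

/-- If a chord `r` separates two chords `p`, `q` that cross the same chords, and these are not
isolated, there is a decomposition. -/
theorem isBlockDecomposable_of_separated_pair {p q r a : Fin (2 * n)}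
    (hpq : ∀ x, ¬ (x = p ∨ x = m.toFun p ∨ x = q ∨ x = m.toFun q) →
      (m.Crosses p x ↔ m.Crosses q x))
    (hp : StrictlyBetween r (m.toFun r) p) (hp' : StrictlyBetween r (m.toFun r) (m.toFun p))
    (hq : ¬ StrictlyBetween r (m.toFun r) q) (hq' : ¬ StrictlyBetween r (m.toFun r) (m.toFun q))
    (hqr : q ≠ r) (hqr' : q ≠ m.toFun r) (hpa : m.Crosses p a) :
    m.IsBlockDecomposable := by
  -- `P` is the closed arc of `p` away from `r`, and `Q` the open arc of `q` away from `r`. Any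
  -- other chord has exactly one end in `P` iff it crosses `p`, iff it crosses `q`, iff it has
  -- exactly one end in `Q`; as the arcs are disjoint, `P ∪ Q` is a union of chords. It contains `p`
  -- and an end of `a`, and omits `q` and `r`.
  set P : Set (Fin (2 * n)) := {x | min (p : ℕ) (m.toFun p) ≤ (x : ℕ) ∧
    (x : ℕ) < max (p : ℕ) (m.toFun p) + 1} with hP
  set Q : Set (Fin (2 * n)) := {x | x ≠ q ∧ x ≠ m.toFun q ∧
    ¬ (StrictlyBetween q (m.toFun q) x ↔ StrictlyBetween q (m.toFun q) r)} with hQ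
  have hv := m.val_ne_of_ne hqr hqr'
  have hqq := m.toFun_val_ne q
  have hap := hpa.ne
  have hPb : (boundary P).ncard ≤ 2 := ncard_boundary_interval_le _ _
  have hQb : (boundary Q).ncard ≤ 2 := by
    by_cases h : StrictlyBetween q (m.toFun q) r
    · have e : Qᶜ = {x : Fin (2 * n) | min (q : ℕ) (m.toFun q) ≤ (x : ℕ) ∧
          (x : ℕ) < max (q : ℕ) (m.toFun q) + 1} := by
        ext x
        simp only [hQ, Set.mem_compl_iff, Set.mem_ofPred_eq, ne_eq, Fin.ext_iff]
        unfold StrictlyBetween at *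
        omega
      rw [← boundary_compl, e]
      exact ncard_boundary_interval_le _ _
    · have e : Q = {x : Fin (2 * n) | StrictlyBetween q (m.toFun q) x} := by
        ext x
        simp only [hQ, Set.mem_ofPred_eq, ne_eq, Fin.ext_iff]
        unfold StrictlyBetween at *
        omega
      rw [e]
      exact ncard_boundary_strictlyBetween_le _ _
  have hpP : p ∈ P ∧ m.toFun p ∈ P := by
    simp only [hP, Set.mem_ofPred_eq]
    omega
  have hPr : ∀ y ∈ P, StrictlyBetween r (m.toFun r) y :=
    fun y hy => StrictlyBetween.of_mem_interval hp hp' hy.1 hy.2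
  have hqP : q ∉ P ∪ Q ∧ m.toFun q ∉ P ∪ Q :=
    ⟨fun h => h.elim (fun h => hq (hPr _ h)) fun h => h.1 rfl,
      fun h => h.elim (fun h => hq' (hPr _ h)) fun h => h.2.1 rfl⟩
  have hinv : m.IsInvariant (P ∪ Q) := by
    intro x
    by_cases hx : x = p ∨ x = m.toFun p ∨ x = q ∨ x = m.toFun q
    · rcases hx with rfl | rfl | rfl | rfl
      · exact iff_of_true (Or.inl hpP.2) (Or.inl hpP.1)
      · rw [toFun_toFun]
        exact iff_of_true (Or.inl hpP.1) (Or.inl hpP.2)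
      · exact iff_of_false hqP.2 hqP.1
      · rw [toFun_toFun]
        exact iff_of_false hqP.1 hqP.2
    · have hc := hpq x hx
      push Not at hx
      have h1 := m.val_ne_of_ne hx.1 hx.2.1
      have h2 := m.val_ne_of_ne hx.2.2.1 hx.2.2.2
      have mem : ∀ y : Fin (2 * n), (y : ℕ) ≠ p → (y : ℕ) ≠ m.toFun p → (y : ℕ) ≠ q →
          (y : ℕ) ≠ m.toFun q → ((y ∈ P ↔ StrictlyBetween p (m.toFun p) y) ∧
          (y ∈ Q ↔ ¬ (StrictlyBetween q (m.toFun q) y ↔ StrictlyBetween q (m.toFun q) r)) ∧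
          ¬ (y ∈ P ∧ y ∈ Q)) := by
        intro y b1 b2 b3 b4
        have c1 : y ∈ P ↔ StrictlyBetween p (m.toFun p) y := by
          simp only [hP, Set.mem_ofPred_eq, StrictlyBetween]
          omega
        have c2 : y ∈ Q ↔
            ¬ (StrictlyBetween q (m.toFun q) y ↔ StrictlyBetween q (m.toFun q) r) := by
          simp only [hQ, Set.mem_ofPred_eq, ne_eq, Fin.ext_iff, b3, b4, not_false_eq_true,
            true_and]
        refine ⟨c1, c2, ?_⟩
        rw [c1, c2]
        -- A point of `P` is on the `p`-side of `r`, while the chord `q` lies on the other side, so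
        -- `q` cannot separate that point from `r`.
        exact fun h => h.2 (strictlyBetween_iff_of_nested hp hp' hq hq' hv.1 hv.2.1 hv.2.2.1
          hv.2.2.2 h.1)
      have k1 := mem x h1.1 h1.2.1 h2.1 h2.2.1
      have k2 := mem (m.toFun x) h1.2.2.1 h1.2.2.2 h2.2.2.1 h2.2.2.2
      have d1 := k1.2.2
      have d2 := k2.2.2
      rw [k1.1, k1.2.1] at d1
      rw [k2.1, k2.2.1] at d2
      rw [Set.mem_union, Set.mem_union, k1.1, k1.2.1, k2.1, k2.2.1]
      exact or_not_iff_congr hc d1 d2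
  refine ⟨P ∪ Q, hinv, ?_, ?_, (ncard_boundary_union_le P Q).trans (by omega)⟩
  · refine ⟨p, Or.inl ⟨by omega, by omega⟩, ?_⟩
    by_cases h : StrictlyBetween p (m.toFun p) a
    · refine ⟨a, Or.inl ?_, hap.1, hap.2⟩
      simp only [hP, Set.mem_ofPred_eq]
      unfold StrictlyBetween at h
      omega
    · refine ⟨a, ?_, hap.1, hap.2⟩
      rw [← hinv]
      refine Or.inl ?_
      have h' : StrictlyBetween p (m.toFun p) (m.toFun a) := by
        by_contra h'
        exact hpa (iff_of_false h h')
      simp only [hP, Set.mem_ofPred_eq]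
      unfold StrictlyBetween at h'
      omega
  · refine ⟨r, fun h => h.elim (fun h => ?_) fun h => h.2.2 Iff.rfl, q, hqP.1, hqr, hqr'⟩
    have := hPr _ h
    unfold StrictlyBetween at this
    omega

/-- A chord `r` outside `S` that meets no chord of `S` and has chords of `S` on both sides gives
a decomposition, or a set with smaller boundary. -/
theorem isBlockDecomposable_or_exists_smaller {S : Set (Fin (2 * n))} (hS : m.IsInvariant S)
    (h1 : m.IsRankOne S) (h2 : m.HasTwoChords S) (h3 : m.HasTwoChords Sᶜ) {r y z : Fin (2 * n)}
    (hr : r ∉ S) (hrS : ∀ s ∈ S, ¬ m.Crosses r s) (hy : y ∈ S)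
    (hry : StrictlyBetween r (m.toFun r) y) (hz : z ∈ S)
    (hrz : ¬ StrictlyBetween r (m.toFun r) z) :
    m.IsBlockDecomposable ∨ ∃ S', m.IsInvariant S' ∧ m.IsRankOne S' ∧ m.HasTwoChords S' ∧
      m.HasTwoChords S'ᶜ ∧ (boundary S').ncard < (boundary S).ncard := by
  have hr' : m.toFun r ∉ S := fun h => hr ((hS r).1 h)
  have side : ∀ s ∈ S, (StrictlyBetween r (m.toFun r) s ↔
      StrictlyBetween r (m.toFun r) (m.toFun s)) := fun s hs => not_not.1 (hrS s hs)
  have hval : ∀ s ∈ S, (s : ℕ) ≠ r ∧ (s : ℕ) ≠ m.toFun r := fun s hs =>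
    ⟨fun e => hr (Fin.ext e ▸ hs), fun e => hr' (Fin.ext e ▸ hs)⟩
  have parallel : ∀ u ∈ S, ∀ v ∈ S, StrictlyBetween r (m.toFun r) u →
      ¬ StrictlyBetween r (m.toFun r) v → ¬ m.Crosses u v := by
    intro u hu v hv hru hrv hc
    have hu' := (side u hu).1 hru
    have hv' := mt (side v hv).2 hrv
    have a1 := hval v hv
    have a2 := hval _ ((hS v).2 hv)
    refine hc ⟨fun h => absurd (StrictlyBetween.trans hru hu' h) hrv,
      fun h => absurd (StrictlyBetween.trans hru hu' h) hv'⟩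
  -- Changing side of `r` requires passing an end of `r`, which is not in `S`; so no cyclic run of
  -- `S` is cut in the middle.
  have adjacent : ∀ s : Fin (2 * n), s ∈ S → s + 1 ∈ S → (StrictlyBetween r (m.toFun r) s ↔
      StrictlyBetween r (m.toFun r) (s + 1 : Fin (2 * n))) := by
    intro s a1 a2
    have b1 := hval _ a1
    have b2 := hval _ a2
    have b3 := r.isLt
    have b4 := (m.toFun r).isLt
    unfold StrictlyBetween
    rcases val_add_one_cases s with h | h <;> omega
  -- The proposition `p` selects a side of `r`: `True` for the positions between its ends, `False`
  -- for the others. The part of `S` on that side inherits rank one because it crosses nothing of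
  -- the rest of `S`, and it loses the boundary points belonging to the other part.
  have smaller : ∀ p : Prop, (∃ s ∈ S, ¬ (StrictlyBetween r (m.toFun r) s ↔ p)) →
      (∃ s ∈ S, (StrictlyBetween r (m.toFun r) s ↔ p)) →
      m.HasTwoChords {s | s ∈ S ∧ (StrictlyBetween r (m.toFun r) s ↔ p)} →
      ∃ S', m.IsInvariant S' ∧ m.IsRankOne S' ∧ m.HasTwoChords S' ∧
      m.HasTwoChords S'ᶜ ∧ (boundary S').ncard < (boundary S).ncard := by
    rintro p ⟨w, hw, hwp⟩ ⟨w', hw', hwp'⟩ h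
    have hsubset : {s | s ∈ S ∧ (StrictlyBetween r (m.toFun r) s ↔ p)} ⊆ S := fun s hs => hs.1
    refine ⟨_, ?_, ?_, h, h3.mono (Set.compl_subset_compl.2 hsubset), ?_⟩
    · intro s
      exact ⟨fun hs => ⟨(hS s).1 hs.1, (side s ((hS s).1 hs.1)).trans hs.2⟩,
        fun hs => ⟨(hS s).2 hs.1, (side s hs.1).symm.trans hs.2⟩⟩
    · have out : ∀ u ∈ {s | s ∈ S ∧ (StrictlyBetween r (m.toFun r) s ↔ p)},
          ∀ v ∉ {s | s ∈ S ∧ (StrictlyBetween r (m.toFun r) s ↔ p)}, m.Crosses u v → v ∉ S := by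
        intro u hu v hv hc hvS
        have hvp : ¬ (StrictlyBetween r (m.toFun r) v ↔ p) := fun h => hv ⟨hvS, h⟩
        by_cases hru : StrictlyBetween r (m.toFun r) u
        · exact parallel u hu.1 v hvS hru (fun hrv => hvp (iff_of_true hrv (hu.2.1 hru))) hc
        · have hp : ¬ p := fun hp => hru (hu.2.2 hp)
          refine parallel v hvS u hu.1 (by_contra fun hrv => hvp (iff_of_false hrv hp)) hru hc.symm
      intro u hu u' hu' v hv v' hv' hc hc'
      exact h1 u hu.1 u' hu'.1 v (out u hu v hv hc) v' (out u' hu' v' hv' hc') hc hc'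
    · have mono : boundary {s | s ∈ S ∧ (StrictlyBetween r (m.toFun r) s ↔ p)} ⊆ boundary S \
          boundary {s | s ∈ S ∧ ¬ (StrictlyBetween r (m.toFun r) s ↔ p)} := by
        intro s hs
        have key := adjacent s
        simp only [boundary, Set.mem_ofPred_eq, Set.mem_sdiff] at hs ⊢
        clear * - key hs
        grind
      refine Set.ncard_lt_ncard ⟨fun s hs => (mono hs).1, fun hsub => ?_⟩ (Set.toFinite _)
      obtain ⟨s, hs, hs'⟩ := exists_mem_add_one_notMem
        (S := {s | s ∈ S ∧ ¬ (StrictlyBetween r (m.toFun r) s ↔ p)}) ⟨w, hw, hwp⟩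
        ⟨r, fun h => hr h.1⟩
      have hsb : s ∈ boundary {s | s ∈ S ∧ ¬ (StrictlyBetween r (m.toFun r) s ↔ p)} :=
        fun h => hs' (h.1 hs)
      have hsb' : s ∈ boundary S := fun h => hs' ⟨h.1 hs.1, fun h' =>
        hs.2 ((adjacent s hs.1 (h.1 hs.1)).trans h')⟩
      exact (mono (hsub hsb')).2 hsb
  by_cases hin : m.HasTwoChords {s | s ∈ S ∧ (StrictlyBetween r (m.toFun r) s ↔ True)}
  · exact Or.inr (smaller True ⟨z, hz, by simpa using hrz⟩ ⟨y, hy, by simpa using hry⟩ hin)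
  by_cases hout : m.HasTwoChords {s | s ∈ S ∧ (StrictlyBetween r (m.toFun r) s ↔ False)}
  · exact Or.inr (smaller False ⟨y, hy, by simpa using hry⟩ ⟨z, hz, by simpa using hrz⟩ hout)
  left
  -- Each side of `r` now carries only one chord of `S`. If neither of these two is isolated, rank
  -- one makes them cross the same chords, and `r` separates them.
  have hSe : ∀ s ∈ S, s = y ∨ s = m.toFun y ∨ s = z ∨ s = m.toFun z := by
    intro s hs
    by_contra hc
    push Not at hc
    by_cases h : StrictlyBetween r (m.toFun r) s
    · exact hin ⟨y, ⟨hy, by simpa using hry⟩, s, ⟨hs, by simpa using h⟩, hc.1, hc.2.1⟩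
    · exact hout ⟨z, ⟨hz, by simpa using hrz⟩, s, ⟨hs, by simpa using h⟩, hc.2.2.1, hc.2.2.2⟩
  have hn := four_le_of_hasTwoChords hS h2 h3
  by_cases hyi : ∀ x, ¬ m.Crosses y x
  · exact isBlockDecomposable_of_isolated hn hyi
  by_cases hzi : ∀ x, ¬ m.Crosses z x
  · exact isBlockDecomposable_of_isolated hn hzi
  push Not at hyi hzi
  obtain ⟨a, ha⟩ := hyi
  obtain ⟨b, hb⟩ := hzi
  have hyz := parallel y hy z hz hry hrz
  have haS : a ∉ S := by
    intro h
    rcases hSe a h with rfl | rfl | rfl | rfl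
    · exact m.not_crosses_self _ ha
    · exact m.not_crosses_self _ ((m.crosses_toFun_right _ _).1 ha)
    · exact hyz ha
    · exact hyz ((m.crosses_toFun_right _ _).1 ha)
  have hbS : b ∉ S := by
    intro h
    rcases hSe b h with rfl | rfl | rfl | rfl
    · exact hyz hb.symm
    · exact hyz ((m.crosses_toFun_right _ _).1 hb).symm
    · exact m.not_crosses_self _ hb
    · exact m.not_crosses_self _ ((m.crosses_toFun_right _ _).1 hb)
  refine isBlockDecomposable_of_separated_pair (p := y) (q := z) (r := r) (a := a) ?_ hry
    ((side y hy).1 hry) hrz (mt (side z hz).2 hrz) ?_ ?_ ha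
  · intro x hx
    have hxS : x ∉ S := fun h => hx (hSe x h)
    exact ⟨h1 z hz y hy b hbS x hxS hb, h1 y hy z hz a haS x hxS ha⟩
  · rintro rfl
    exact hr hz
  · rintro rfl
    exact hr' hz

end Matching

/-! ### Monochromatic blocks and their indices. -/

theorem exists_threshold {p : ℕ → Prop} (hp : ∀ x y, x ≤ y → p y → p x) (N : ℕ) :
    ∃ a, ∀ x < N, p x ↔ x < a := by
  induction N with
  | zero => exact ⟨0, fun x hx => absurd hx (by omega)⟩
  | succ N ih =>
    by_cases h : p N
    · exact ⟨N + 1, fun x hx => iff_of_true (hp x N (by omega) h) hx⟩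
    · obtain ⟨a, ha⟩ := ih
      refine ⟨min a N, fun x hx => ?_⟩
      rcases Nat.lt_succ_iff_lt_or_eq.1 hx with hx | rfl
      · rw [ha x hx]
        omega
      · exact iff_of_false h (by omega)

theorem exists_interval_of_monotone {g : ℕ → ℕ} (hg : Monotone g) (i N : ℕ) :
    ∃ a b, ∀ x < N, g x = i ↔ a ≤ x ∧ x < b := by
  obtain ⟨a, ha⟩ := exists_threshold (p := fun x => g x < i)
    (fun x y h hy => (hg h).trans_lt hy) N
  obtain ⟨b, hb⟩ := exists_threshold (p := fun x => g x < i + 1)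
    (fun x y h hy => (hg h).trans_lt hy) N
  refine ⟨a, b, fun x hx => ?_⟩
  have := ha x hx
  have := hb x hx
  omega

/-- On the circle, `u` is in the arc from `j` to `k` avoiding `i`. To cross both `ij` and `ik`, the
chord `uv` would need `v` in the arc cut off by `ij` and in the disjoint arc cut off by `ik`. -/
theorem not_separates_both {i j k u v : ℕ} (hjk : j < k) (hu : (j < u ∧ u < k) ↔ ¬ (j < i ∧ i < k))
    (h1 : ¬ (StrictlyBetween i j u ↔ StrictlyBetween i j v))
    (h2 : ¬ (StrictlyBetween i k u ↔ StrictlyBetween i k v)) : False := by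
  unfold StrictlyBetween at h1 h2
  have hcase : i < j ∨ (j < i ∧ i < k) ∨ k < i ∨ i = k := by omega
  rcases hcase with h | h | h | h <;> omega

namespace Matching

section Blocks

variable {n : ℕ}

open Classical in
/-- The number of changes of membership in `S` before the position `k`. -/
noncomputable def blockIndex (S : Set (Fin (2 * n))) (k : ℕ) : ℕ :=
  Nat.count (fun k => ¬ (k ∈ Fin.val '' S ↔ k + 1 ∈ Fin.val '' S)) k

variable (S : Set (Fin (2 * n)))

theorem blockIndex_zero : blockIndex S 0 = 0 := by
  classical exact Nat.count_zero _

theorem blockIndex_mono : Monotone (blockIndex S) := by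
  classical exact Nat.count_monotone _

theorem val_mem_image_iff (x : Fin (2 * n)) : (x : ℕ) ∈ Fin.val '' S ↔ x ∈ S :=
  Fin.val_injective.mem_set_image

theorem blockIndex_succ (k : ℕ) :
    ((k ∈ Fin.val '' S ↔ k + 1 ∈ Fin.val '' S) ∧ blockIndex S (k + 1) = blockIndex S k) ∨
      (¬ (k ∈ Fin.val '' S ↔ k + 1 ∈ Fin.val '' S) ∧
        blockIndex S (k + 1) = blockIndex S k + 1) := by
  unfold blockIndex
  rw [Nat.count_succ]
  by_cases h : k ∈ Fin.val '' S ↔ k + 1 ∈ Fin.val '' S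
  · exact Or.inl ⟨h, by simp [h]⟩
  · exact Or.inr ⟨h, by rw [if_pos h]⟩

/-- Each change of membership flips the parity of the index, so parity records the colour relative
to position 0. -/
theorem mem_image_iff_even (k : ℕ) :
    (k ∈ Fin.val '' S ↔ 0 ∈ Fin.val '' S) ↔ blockIndex S k % 2 = 0 := by
  induction k with
  | zero => simp [blockIndex_zero]
  | succ k ih =>
    rcases blockIndex_succ S k with ⟨h, h'⟩ | ⟨h, h'⟩
    · rw [h', ← ih, h]
    · rw [h']
      have : (blockIndex S k + 1) % 2 = 0 ↔ ¬ blockIndex S k % 2 = 0 := by omega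
      rw [this, ← ih]
      tauto

theorem mem_iff_mem_iff_blockIndex (x y : Fin (2 * n)) :
    (x ∈ S ↔ y ∈ S) ↔ blockIndex S x % 2 = blockIndex S y % 2 := by
  have hx := mem_image_iff_even S x
  have hy := mem_image_iff_even S y
  rw [val_mem_image_iff] at hx hy
  have : blockIndex S x % 2 = blockIndex S y % 2 ↔
      (blockIndex S x % 2 = 0 ↔ blockIndex S y % 2 = 0) := by omega
  rw [this, ← hx, ← hy]
  tauto

theorem exists_blockIndex_eq (y : Fin (2 * n)) {k : ℕ} (hk : k ≤ blockIndex S y) :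
    ∃ z : Fin (2 * n), blockIndex S z = k := by
  have key : ∀ N, k ≤ blockIndex S N → ∃ z ≤ N, blockIndex S z = k := by
    intro N
    induction N with
    | zero =>
      intro h
      rw [blockIndex_zero] at h
      exact ⟨0, le_rfl, by rw [blockIndex_zero]; omega⟩
    | succ N ih =>
      intro h
      by_cases h' : k ≤ blockIndex S N
      · obtain ⟨z, hz, hz'⟩ := ih h'
        exact ⟨z, by omega, hz'⟩
      · refine ⟨N + 1, le_rfl, ?_⟩
        rcases blockIndex_succ S N with h | h <;> omega
  obtain ⟨z, hz, hz'⟩ := key y hk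
  exact ⟨⟨z, by omega⟩, hz'⟩

theorem lt_of_blockIndex_lt {x y : ℕ} (h : blockIndex S x < blockIndex S y) : x < y :=
  (blockIndex_mono S).reflect_lt h

theorem ncard_boundary_block_le [NeZero n] (i : ℕ) :
    (boundary {x : Fin (2 * n) | blockIndex S x = i}).ncard ≤ 2 := by
  obtain ⟨a, b, hab⟩ := exists_interval_of_monotone (blockIndex_mono S) i (2 * n)
  have : {x : Fin (2 * n) | blockIndex S x = i} =
      {x : Fin (2 * n) | a ≤ (x : ℕ) ∧ (x : ℕ) < b} := by
    ext x
    exact hab x x.isLt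
  rw [this]
  exact ncard_boundary_interval_le a b

/-- Positions in different blocks are ordered as their blocks are, so crossings between chords of
different colours can be read off block indices. -/
theorem strictlyBetween_blockIndex {a b x : ℕ} (ha : blockIndex S a ≠ blockIndex S x)
    (hb : blockIndex S b ≠ blockIndex S x) :
    StrictlyBetween a b x ↔
      StrictlyBetween (blockIndex S a) (blockIndex S b) (blockIndex S x) := by
  have h1 : ∀ u v : ℕ, blockIndex S u ≠ blockIndex S v →
      (u < v ↔ blockIndex S u < blockIndex S v) := fun u v h =>
    ⟨fun h' => lt_of_le_of_ne (blockIndex_mono S h'.le) h, lt_of_blockIndex_lt S⟩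
  unfold StrictlyBetween
  rw [h1 a x ha, h1 x b hb.symm, h1 b x hb, h1 x a ha.symm]

end Blocks

/-! ### The unseparated case. -/

section NoSeparation

variable {n : ℕ} {m : Matching n} {S : Set (Fin (2 * n))}

theorem IsRankOne.crosses (h : m.IsRankOne S) {x x' y y' : Fin (2 * n)} (hxx : x ∈ S ↔ x' ∈ S)
    (hyy : y ∈ S ↔ y' ∈ S) (hxy : ¬ (x ∈ S ↔ y ∈ S)) (hc : m.Crosses x y)
    (hc' : m.Crosses x' y') : m.Crosses x y' := by
  by_cases hx : x ∈ S
  · exact h x hx x' (hxx.1 hx) y (by tauto) y' (by tauto) hc hc'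
  · exact h.compl x hx x' (by rwa [Set.mem_compl_iff, ← hxx]) y (by simp; tauto) y'
      (by simp; tauto) hc hc'

/-- Every chord that crosses no chord of the other side has the other side in one of its two
half-planes. -/
def IsUnseparated (m : Matching n) (S : Set (Fin (2 * n))) : Prop :=
  ∀ r, (∀ s, ¬ (r ∈ S ↔ s ∈ S) → ¬ m.Crosses r s) → ∀ y z, ¬ (r ∈ S ↔ y ∈ S) →
    ¬ (r ∈ S ↔ z ∈ S) → (StrictlyBetween r (m.toFun r) y ↔ StrictlyBetween r (m.toFun r) z)

/-- The block following the lower end of the chord has the other colour and lies between the ends.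
One of the extreme positions `e`, `l` also has the other colour and lies outside. A chord crossing
none of that colour would therefore separate it. -/
theorem exists_crosses_of_blockIndex_ne (hS : m.IsInvariant S) (hsep : m.IsUnseparated S)
    {e l : Fin (2 * n)} (he : (e : ℕ) = 0) (hl : (l : ℕ) + 1 = 2 * n) (hel : ¬ (e ∈ S ↔ l ∈ S))
    {x : Fin (2 * n)} (hx : blockIndex S x ≠ blockIndex S (m.toFun x)) :
    ∃ s, ¬ (x ∈ S ↔ s ∈ S) ∧ m.Crosses x s := by
  have key : ∀ x : Fin (2 * n), blockIndex S x < blockIndex S (m.toFun x) →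
      ∃ s, ¬ (x ∈ S ↔ s ∈ S) ∧ m.Crosses x s := by
    intro x hx
    by_contra hc'
    have hc : ∀ s, ¬ (x ∈ S ↔ s ∈ S) → ¬ m.Crosses x s := fun s h h' => hc' ⟨s, h, h'⟩
    have hpar := (mem_iff_mem_iff_blockIndex S _ _).1 (hS x)
    obtain ⟨z, hz⟩ := exists_blockIndex_eq S (m.toFun x) (k := blockIndex S x + 1) hx
    have hxz : ¬ (x ∈ S ↔ z ∈ S) := by
      rw [mem_iff_mem_iff_blockIndex]
      omega
    have h1 : (x : ℕ) < z := lt_of_blockIndex_lt S (by omega)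
    have h2 : (z : ℕ) < m.toFun x := lt_of_blockIndex_lt S (by omega)
    have hxl := (m.toFun x).isLt
    by_cases hxe : x ∈ S ↔ e ∈ S
    · have := (hsep x hc z l hxz (by tauto)).1 (Or.inl ⟨h1, h2⟩)
      unfold StrictlyBetween at this
      omega
    · have := (hsep x hc z e hxz hxe).1 (Or.inl ⟨h1, h2⟩)
      unfold StrictlyBetween at this
      omega
  rcases lt_or_gt_of_ne hx with h | h
  · exact key x h
  · obtain ⟨s, h1, h2⟩ := key (m.toFun x) (by rwa [toFun_toFun])
    rw [hS x] at h1
    exact ⟨s, h1, (m.crosses_toFun_left _ _).1 h2⟩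

theorem blockIndex_toFun_eq (hS : m.IsInvariant S) (h1 : m.IsRankOne S)
    (hact : ∀ x : Fin (2 * n), blockIndex S x ≠ blockIndex S (m.toFun x) →
      ∃ s, ¬ (x ∈ S ↔ s ∈ S) ∧ m.Crosses x s)
    (hout : ∀ x : Fin (2 * n), ∃ y : Fin (2 * n), blockIndex S y = blockIndex S x ∧
      blockIndex S y ≠ blockIndex S (m.toFun y))
    {e l : Fin (2 * n)} (he : (e : ℕ) = 0) (hl : (l : ℕ) + 1 = 2 * n) (hel : ¬ (e ∈ S ↔ l ∈ S))
    {x x' : Fin (2 * n)} (hxx : blockIndex S x = blockIndex S x')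
    (hx : blockIndex S x ≠ blockIndex S (m.toFun x))
    (hx' : blockIndex S x' ≠ blockIndex S (m.toFun x')) :
    blockIndex S (m.toFun x) = blockIndex S (m.toFun x') := by
  have key : ∀ x x' : Fin (2 * n), blockIndex S x = blockIndex S x' →
      blockIndex S x ≠ blockIndex S (m.toFun x) → blockIndex S x' ≠ blockIndex S (m.toFun x') →
      ¬ blockIndex S (m.toFun x) < blockIndex S (m.toFun x') := by
    intro x x' hxx hx hx' hlt
    have p1 := (mem_iff_mem_iff_blockIndex S _ _).1 (hS x)
    have p2 := (mem_iff_mem_iff_blockIndex S _ _).1 (hS x')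
    -- Find a block of the other colour in the arc between the two target blocks that avoids the
    -- block of `x`. If that arc runs through the seam, `e` or `l` serves; otherwise the block just
    -- after the lower target does. An outgoing chord of `w` crosses both chords by rank one,
    -- against `not_separates_both`.
    obtain ⟨w, hw, hw'⟩ : ∃ w : Fin (2 * n), blockIndex S w % 2 ≠ blockIndex S x % 2 ∧
        ((blockIndex S (m.toFun x) < blockIndex S w ∧
          blockIndex S w < blockIndex S (m.toFun x')) ↔
        ¬ (blockIndex S (m.toFun x) < blockIndex S x ∧
          blockIndex S x < blockIndex S (m.toFun x'))) := by
      by_cases hc : blockIndex S (m.toFun x) < blockIndex S x ∧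
          blockIndex S x < blockIndex S (m.toFun x')
      · have e1 : blockIndex S e = 0 := by rw [he, blockIndex_zero]
        have e2 : ∀ y : Fin (2 * n), blockIndex S y ≤ blockIndex S l := fun y =>
          blockIndex_mono S (by omega)
        rw [mem_iff_mem_iff_blockIndex] at hel
        by_cases hp : blockIndex S e % 2 = blockIndex S x % 2
        · refine ⟨l, by omega, ?_⟩
          have := e2 (m.toFun x')
          omega
        · exact ⟨e, hp, by omega⟩
      · obtain ⟨w, hw⟩ := exists_blockIndex_eq S (m.toFun x')
          (k := blockIndex S (m.toFun x) + 1) (by omega)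
        exact ⟨w, by omega, by omega⟩
    obtain ⟨y, hy, hyo⟩ := hout w
    obtain ⟨s, hs, hxs⟩ := hact x hx
    obtain ⟨s', hs', hxs'⟩ := hact x' hx'
    obtain ⟨t, ht, hyt⟩ := hact y hyo
    have p3 := (mem_iff_mem_iff_blockIndex S _ _).1 (hS y)
    rw [mem_iff_mem_iff_blockIndex] at hs hs' ht
    have c1 : m.Crosses x y := by
      refine h1.crosses (y := s) ?_ ?_ ?_ hxs hyt.symm <;>
      rw [mem_iff_mem_iff_blockIndex] <;> omega
    have c2 : m.Crosses x' y := by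
      refine h1.crosses (y := s') ?_ ?_ ?_ hxs' hyt.symm <;>
      rw [mem_iff_mem_iff_blockIndex] <;> omega
    unfold Crosses at c1 c2
    rw [strictlyBetween_blockIndex S (x := y) (by omega) (by omega),
      strictlyBetween_blockIndex S (x := m.toFun y) (by omega) (by omega), hy] at c1 c2
    rw [← hxx] at c2
    exact not_separates_both hlt hw' c1 c2
  have k1 := key x x' hxx hx hx'
  have k2 := key x' x hxx.symm hx' hx
  omega

variable [NeZero n]

/-- A coloring of the positions in which adjacent positions have different colors and all chords of
different colors cross. -/
theorem isBlockDecomposable_of_alternating (hn : 4 ≤ n) (hS : m.IsInvariant S)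
    (h2 : m.HasTwoChords S) (h3 : m.HasTwoChords Sᶜ)
    (halt : ∀ x y : Fin (2 * n), (y : ℕ) = x + 1 → ¬ (x ∈ S ↔ y ∈ S))
    (hcr : ∀ x y, ¬ (x ∈ S ↔ y ∈ S) → m.Crosses x y) : m.IsBlockDecomposable := by
  obtain ⟨a, ha⟩ : ∃ a : Fin (2 * n), (a : ℕ) = 0 := ⟨⟨0, by omega⟩, rfl⟩
  obtain ⟨b, hb⟩ : ∃ b : Fin (2 * n), (b : ℕ) = 1 := ⟨⟨1, by omega⟩, rfl⟩
  have hab := halt a b (by omega)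
  have hc := hcr a b hab
  have hv := m.val_ne_of_ne hc.ne.1 hc.ne.2
  have hlt : (m.toFun a : ℕ) < m.toFun b := by
    have := m.toFun_val_ne a
    have := m.toFun_val_ne b
    unfold Crosses StrictlyBetween at hc
    omega
  -- If there is a gap, let `u` be its first position and `z` its last. Crossing `a` sends the chord
  -- of `u` to the left of the gap, crossing `b` sends that of `z` to the right (or to position 0,
  -- which is already the partner of `m.toFun a`). Then `u` and `z`, of opposite colours, do not
  -- cross.
  have hsucc : (m.toFun b : ℕ) = m.toFun a + 1 := by
    by_contra hne
    have hbl := (m.toFun b).isLt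
    obtain ⟨u, hu⟩ : ∃ u : Fin (2 * n), (u : ℕ) = m.toFun a + 1 := ⟨⟨_, by omega⟩, rfl⟩
    obtain ⟨z, hz⟩ : ∃ z : Fin (2 * n), (z : ℕ) + 1 = m.toFun b := ⟨⟨m.toFun b - 1, by omega⟩, by
      simp only; omega⟩
    have hau := halt _ _ hu
    have hzb := halt _ _ hz.symm
    rw [hS] at hau hzb
    have c1 := hcr a u hau
    have c2 := hcr b z (by tauto)
    have c3 := hcr u z (by tauto)
    have v1 := m.val_ne_of_ne c1.ne.1 c1.ne.2
    have v2 := m.val_ne_of_ne c2.ne.1 c2.ne.2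
    have v3 := m.val_ne_of_ne c3.ne.1 c3.ne.2
    have d1 : (m.toFun u : ℕ) < m.toFun a := by
      unfold Crosses StrictlyBetween at c1
      omega
    have d2 : (m.toFun b : ℕ) < m.toFun z ∨ (m.toFun z : ℕ) = 0 := by
      unfold Crosses StrictlyBetween at c2
      omega
    unfold Crosses StrictlyBetween at c3
    omega
  have e : ({a, m.toFun a} ∪ {b, m.toFun b} : Set (Fin (2 * n))) =
      {x : Fin (2 * n) | 0 ≤ (x : ℕ) ∧ (x : ℕ) < 2} ∪
      {x : Fin (2 * n) | (m.toFun a : ℕ) ≤ (x : ℕ) ∧ (x : ℕ) < m.toFun a + 2} := by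
    ext x
    simp only [Set.mem_union, Set.mem_insert_iff, Set.mem_singleton_iff, Set.mem_ofPred_eq,
      Fin.ext_iff]
    omega
  refine ⟨{a, m.toFun a} ∪ {b, m.toFun b}, (isInvariant_pair a).union (isInvariant_pair b),
    ⟨a, by simp, b, by simp, hc.ne.1, hc.ne.2⟩, ?_, ?_⟩
  · have other : ∀ {S : Set (Fin (2 * n))}, m.HasTwoChords S → ∀ a : Fin (2 * n),
        ∃ x ∈ S, x ≠ a ∧ x ≠ m.toFun a := by
      rintro S ⟨x, hx, y, hy, h, h'⟩ a
      by_contra hc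
      push Not at hc
      have k1 : x = a ∨ x = m.toFun a := by
        by_contra h
        push Not at h
        exact h.2 (hc x hx h.1)
      have k2 : y = a ∨ y = m.toFun a := by
        by_contra h
        push Not at h
        exact h.2 (hc y hy h.1)
      rcases k1 with rfl | rfl
      · exact k2.elim h h'
      · rw [toFun_toFun] at h'
        exact k2.elim h' h
    have key : ∀ {S : Set (Fin (2 * n))} {a b : Fin (2 * n)}, m.IsInvariant S → m.HasTwoChords S →
        m.HasTwoChords Sᶜ → a ∈ S → b ∉ S →
        m.HasTwoChords ({a, m.toFun a} ∪ {b, m.toFun b} : Set (Fin (2 * n)))ᶜ := by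
      intro S a b hS h2 h3 ha hb
      obtain ⟨x, hx, hx1, hx2⟩ := other h2 a
      obtain ⟨y, hy, hy1, hy2⟩ := other h3 b
      have ne : ∀ {u v}, u ∈ S → v ∉ S → u ≠ v := fun hu hv h => hv (h ▸ hu)
      have ha' := (hS a).2 ha
      have hb' := mt (hS b).1 hb
      refine ⟨x, ?_, y, ?_, (ne hx hy).symm, (ne ((hS x).2 hx) hy).symm⟩
      · rintro ((h | h) | (h | h))
        exacts [hx1 h, hx2 h, ne hx hb h, ne hx hb' h]
      · rintro ((h | h) | (h | h))
        exacts [ne ha hy h.symm, ne ha' hy h.symm, hy1 h, hy2 h]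
    by_cases haS : a ∈ S
    · exact key hS h2 h3 haS (by tauto)
    · rw [Set.union_comm]
      exact key hS h2 h3 (by tauto) haS
  · rw [e]
    refine (ncard_boundary_union_le _ _).trans ?_
    have := ncard_boundary_interval_le (n := n) 0 2
    have := ncard_boundary_interval_le (n := n) (m.toFun a) (m.toFun a + 2)
    omega

theorem isBlockDecomposable_of_isUnseparated (hS : m.IsInvariant S) (h1 : m.IsRankOne S)
    (h2 : m.HasTwoChords S) (h3 : m.HasTwoChords Sᶜ) (hsep : m.IsUnseparated S)
    {e l : Fin (2 * n)} (he : (e : ℕ) = 0) (hl : (l : ℕ) + 1 = 2 * n)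
    (hel : ¬ (e ∈ S ↔ l ∈ S)) : m.IsBlockDecomposable := by
  by_contra hbd
  have hn := four_le_of_hasTwoChords hS h2 h3
  have hopp : ∀ x : Fin (2 * n), ∃ y, ¬ (x ∈ S ↔ y ∈ S) := fun x => by
    by_cases h : x ∈ S ↔ e ∈ S
    · exact ⟨l, by tauto⟩
    · exact ⟨e, h⟩
  have hact := fun x hx => exists_crosses_of_blockIndex_ne hS hsep he hl hel (x := x) hx
  -- A block without outgoing chords would be an invariant interval.
  have hout : ∀ x : Fin (2 * n), ∃ y : Fin (2 * n), blockIndex S y = blockIndex S x ∧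
      blockIndex S y ≠ blockIndex S (m.toFun y) := by
    intro x
    by_contra hc
    push Not at hc
    obtain ⟨y, hy⟩ := hopp x
    refine hbd (isBlockDecomposable_of_interval hn
      (S := {z : Fin (2 * n) | blockIndex S z = blockIndex S x}) ?_ ⟨x, rfl⟩ ⟨y, ?_⟩
      (ncard_boundary_block_le S _))
    · exact IsInvariant.of_mem fun z hz => (hc z hz).symm.trans hz
    · intro h
      rw [mem_iff_mem_iff_blockIndex] at hy
      exact hy (congrArg (· % 2) h.symm)
  have hsingle : ∀ x : Fin (2 * n), blockIndex S x ≠ blockIndex S (m.toFun x) → ∀ y : Fin (2 * n),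
      blockIndex S y = blockIndex S x → y = x := by
    intro x hx y hy
    -- The two blocks joined by the chord at `x` send their outgoing chords only to each other, so
    -- their union is invariant. Its complement contains the entire other colour, hence two chords.
    have htwo : ¬ m.HasTwoChords ({z : Fin (2 * n) | blockIndex S z = blockIndex S x} ∪
        {z : Fin (2 * n) | blockIndex S z = blockIndex S (m.toFun x)}) := by
      intro htwo
      refine hbd ⟨_, ?_, htwo, ?_, (ncard_boundary_union_le _ _).trans (Nat.add_le_add
        (ncard_boundary_block_le S _) (ncard_boundary_block_le S _))⟩
      · refine IsInvariant.of_mem fun z hz => ?_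
        by_cases hzo : blockIndex S z = blockIndex S (m.toFun z)
        · simpa only [Set.mem_union, Set.mem_ofPred_eq, ← hzo] using hz
        · rcases hz with hz | hz
          · exact Or.inr (blockIndex_toFun_eq hS h1 hact hout he hl hel hz hzo hx)
          · refine Or.inl ?_
            have := blockIndex_toFun_eq hS h1 hact hout he hl hel hz hzo
              (by rw [toFun_toFun]; exact hx.symm)
            rwa [toFun_toFun] at this
      · have hpar := (mem_iff_mem_iff_blockIndex S _ _).1 (hS x)
        have hsub : ∀ z : Fin (2 * n), ¬ (z ∈ S ↔ x ∈ S) →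
            z ∈ ({z : Fin (2 * n) | blockIndex S z = blockIndex S x} ∪
              {z : Fin (2 * n) | blockIndex S z = blockIndex S (m.toFun x)})ᶜ := by
          intro z hz
          rw [mem_iff_mem_iff_blockIndex] at hz
          simp only [Set.mem_compl_iff, Set.mem_union, Set.mem_ofPred_eq]
          omega
        by_cases hxS : x ∈ S
        · exact h3.mono fun z hz => hsub z (by simp at hz; tauto)
        · exact h2.mono fun z hz => hsub z (by tauto)
    by_contra hne
    refine htwo ⟨x, Or.inl rfl, y, Or.inl hy, hne, ?_⟩
    rintro rfl
    exact hx hy.symm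
  have hne : ∀ x : Fin (2 * n), blockIndex S x ≠ blockIndex S (m.toFun x) := by
    intro x
    obtain ⟨y, hy, hy'⟩ := hout x
    rw [hsingle y hy' x hy.symm]
    exact hy'
  refine hbd (isBlockDecomposable_of_alternating hn hS h2 h3 ?_ ?_)
  · intro x y hxy h
    have hb : blockIndex S y = blockIndex S x := by
      have h' := blockIndex_succ S x
      rw [← hxy, val_mem_image_iff, val_mem_image_iff] at h'
      tauto
    have := hsingle x (hne x) y hb
    rw [this] at hxy
    omega
  · intro x y hxy
    obtain ⟨s, hs, hxs⟩ := hact x (hne x)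
    obtain ⟨t, ht, hyt⟩ := hact y (hne y)
    exact h1.crosses (by tauto) (by tauto) hs hxs hyt.symm

end NoSeparation

end Matching

/-! ### Rotation invariance and the induction on the boundary. -/

theorem strictlyBetween_shift {N r a b x : ℕ} {a' b' x' : ℕ} (ha : a < N) (hb : b < N) (hx : x < N)
    (ha' : a' = if N ≤ a + r then a + r - N else a + r)
    (hb' : b' = if N ≤ b + r then b + r - N else b + r)
    (hx' : x' = if N ≤ x + r then x + r - N else x + r) (hxa : x ≠ a) (hxb : x ≠ b) :
    (StrictlyBetween a b x ↔ StrictlyBetween a' b' x') ↔ (N ≤ a + r ↔ N ≤ b + r) := by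
  unfold StrictlyBetween
  split_ifs at * <;> omega

namespace Matching

variable {n : ℕ} [NeZero n]

/-- The matching obtained by renaming the position `x + r` to `x`, cyclically. -/
def rotate (m : Matching n) (r : Fin (2 * n)) : Matching n where
  toFun x := m.toFun (x + r) - r
  involutive x := by simp
  fixedPointFree x h := m.fixedPointFree (x + r) (sub_eq_iff_eq_add.1 h)

variable {m : Matching n}

theorem rotate_toFun_add (m : Matching n) (r x : Fin (2 * n)) :
    (m.rotate r).toFun x + r = m.toFun (x + r) := by
  simp [rotate]

theorem crosses_rotate_iff (r x y : Fin (2 * n)) :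
    (m.rotate r).Crosses x y ↔ m.Crosses (x + r) (y + r) := by
  have hiff : (y = x ∨ y = (m.rotate r).toFun x) ↔ (y + r = x + r ∨ y + r = m.toFun (x + r)) := by
    rw [← rotate_toFun_add, add_left_inj, add_left_inj]
  by_cases h : y = x ∨ y = (m.rotate r).toFun x
  · have h' := hiff.1 h
    exact iff_of_false (fun hc => h.elim hc.ne.1 hc.ne.2) (fun hc => h'.elim hc.ne.1 hc.ne.2)
  · push Not at h
    have hv := (m.rotate r).val_ne_of_ne h.1 h.2
    unfold Crosses
    rw [← rotate_toFun_add, ← rotate_toFun_add]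
    have e := fun z : Fin (2 * n) => Fin.val_add_eq_ite z r
    -- Betweenness is flipped exactly when one end of the chord at `x` wraps around and the other
    -- does not. This does not depend on the tested position, so both ends of the chord at `y` are
    -- affected alike.
    have k1 := strictlyBetween_shift x.isLt ((m.rotate r).toFun x).isLt y.isLt
      (e _) (e _) (e _) hv.1 hv.2.1
    have k2 := strictlyBetween_shift x.isLt ((m.rotate r).toFun x).isLt
      ((m.rotate r).toFun y).isLt (e _) (e _) (e _) hv.2.2.1 hv.2.2.2
    tauto

theorem ncard_boundary_preimage (S : Set (Fin (2 * n))) (r : Fin (2 * n)) :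
    (boundary {x | x + r ∈ S}).ncard = (boundary S).ncard := by
  have : boundary {x | x + r ∈ S} = (fun x => x + r) ⁻¹' boundary S := by
    ext x
    simp only [boundary, Set.mem_ofPred_eq, Set.mem_preimage, add_right_comm x 1 r]
  rw [this]
  exact Set.ncard_preimage_of_injective_subset_range (add_left_injective r)
    fun y _ => ⟨y - r, sub_add_cancel y r⟩

theorem IsInvariant.rotate {S : Set (Fin (2 * n))} (h : m.IsInvariant S) (r : Fin (2 * n)) :
    (m.rotate r).IsInvariant {x | x + r ∈ S} := fun x => by
  rw [Set.mem_ofPred_eq, Set.mem_ofPred_eq, rotate_toFun_add]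
  exact h _

theorem HasTwoChords.rotate {S : Set (Fin (2 * n))} (h : m.HasTwoChords S) (r : Fin (2 * n)) :
    (m.rotate r).HasTwoChords {x | x + r ∈ S} := by
  obtain ⟨x, hx, y, hy, h1, h2⟩ := h
  refine ⟨x - r, by simpa using hx, y - r, by simpa using hy, by simpa using h1, fun h => h2 ?_⟩
  have := congrArg (· + r) h
  simpa only [sub_add_cancel, rotate_toFun_add] using this

theorem IsRankOne.rotate {S : Set (Fin (2 * n))} (h : m.IsRankOne S) (r : Fin (2 * n)) :
    (m.rotate r).IsRankOne {x | x + r ∈ S} := by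
  intro x hx x' hx' y hy y' hy' hc hc'
  rw [crosses_rotate_iff] at hc hc' ⊢
  exact h _ hx _ hx' _ hy _ hy' hc hc'

theorem rotate_rotate_neg (r : Fin (2 * n)) : (m.rotate r).rotate (-r) = m := by
  cases m
  simp [rotate]

theorem IsBlockDecomposable.rotate (h : m.IsBlockDecomposable) (r : Fin (2 * n)) :
    (m.rotate r).IsBlockDecomposable := by
  obtain ⟨S, h1, h2, h3, h4⟩ := h
  exact ⟨_, h1.rotate r, h2.rotate r, h3.rotate r, by rwa [ncard_boundary_preimage]⟩

/-- A matching with a nontrivial rank-one union of chords has a block decomposition. -/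
theorem isBlockDecomposable_of_isRankOne {S : Set (Fin (2 * n))} (hS : m.IsInvariant S)
    (h1 : m.IsRankOne S) (h2 : m.HasTwoChords S) (h3 : m.HasTwoChords Sᶜ) :
    m.IsBlockDecomposable := by
  induction hk : (boundary S).ncard using Nat.strong_induction_on generalizing m S with
  | _ k ih =>
    obtain ⟨s, hs, hs'⟩ := exists_mem_add_one_notMem h2.nonempty h3.nonempty
    -- After this rotation `s + 1` sits at 0 and `s` at the last position, so the seam is a colour
    -- change and blocks are linear intervals.
    suffices h : (m.rotate (s + 1)).IsBlockDecomposable by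
      rw [← rotate_rotate_neg (m := m) (s + 1)]
      exact h.rotate _
    have hb := (ncard_boundary_preimage S (s + 1)).trans hk
    have hl : (((-1 : Fin (2 * n)) : Fin (2 * n)) : ℕ) + 1 = 2 * n := by
      rcases val_add_one_cases (-1 : Fin (2 * n)) with h | h
      · rw [neg_add_cancel, val_zero_eq] at h
        omega
      · exact h.1
    have hel : ¬ ((0 : Fin (2 * n)) ∈ {x | x + (s + 1) ∈ S} ↔ -1 ∈ {x | x + (s + 1) ∈ S}) := by
      rw [Set.mem_ofPred_eq, Set.mem_ofPred_eq, zero_add, add_comm s 1, neg_add_cancel_left,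
        add_comm 1 s]
      tauto
    have hS := hS.rotate (s + 1)
    have h1 := h1.rotate (s + 1)
    have h2 := h2.rotate (s + 1)
    have h3 : (m.rotate (s + 1)).HasTwoChords {x | x + (s + 1) ∈ S}ᶜ := h3.rotate (s + 1)
    generalize {x | x + (s + 1) ∈ S} = T at *
    generalize m.rotate (s + 1) = m' at *
    by_cases hsep : m'.IsUnseparated T
    · exact isBlockDecomposable_of_isUnseparated hS h1 h2 h3 hsep val_zero_eq hl hel
    · have key : ∀ T : Set (Fin (2 * n)), m'.IsInvariant T → m'.IsRankOne T → m'.HasTwoChords T →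
          m'.HasTwoChords Tᶜ → (boundary T).ncard = k → ∀ r ∉ T, (∀ s ∈ T, ¬ m'.Crosses r s) →
          ∀ y ∈ T, ∀ z ∈ T, ¬ (StrictlyBetween r (m'.toFun r) y ↔
            StrictlyBetween r (m'.toFun r) z) → m'.IsBlockDecomposable := by
        intro T hS h1 h2 h3 hb r hr hrT y hy z hz hyz
        obtain ⟨y, hy, hry, z, hz, hrz⟩ : ∃ y ∈ T, StrictlyBetween r (m'.toFun r) y ∧ ∃ z ∈ T,
            ¬ StrictlyBetween r (m'.toFun r) z := by
          by_cases h : StrictlyBetween r (m'.toFun r) y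
          · exact ⟨y, hy, h, z, hz, fun h' => hyz (iff_of_true h h')⟩
          · exact ⟨z, hz, by_contra fun h' => hyz (iff_of_false h h'), y, hy, h⟩
        rcases isBlockDecomposable_or_exists_smaller hS h1 h2 h3 hr hrT hy hry hz hrz with
          h | ⟨S', a1, a2, a3, a4, a5⟩
        · exact h
        · exact ih _ (hb ▸ a5) a1 a2 a3 a4 rfl
      -- The separating chord may have either colour; passing to the complement keeps the boundary
      -- and the rank-one property.
      refine by_contra fun hbd => hsep fun r hr y z hy hz => by_contra fun hyz => hbd ?_
      by_cases hrT : r ∈ T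
      · refine key Tᶜ hS.compl h1.compl h3 (by rwa [compl_compl]) (by rwa [boundary_compl]) r
          (fun h => h hrT) (fun s hs => hr s fun h => hs (h.1 hrT)) y (fun h => hy ?_) z
          (fun h => hz ?_) hyz
        · exact iff_of_true hrT h
        · exact iff_of_true hrT h
      · exact key T hS h1 h2 h3 hb r hrT (fun s hs => hr s fun h => hrT (h.2 hs)) y
          (by_contra fun h => hy (iff_of_false hrT h)) z
          (by_contra fun h => hz (iff_of_false hrT h)) hyz

end Matching

/-! ### Plane geometry of chords of the unit circle. -/

open Complex in
theorem re_exp_mul_exp_neg (θ μ : ℝ) :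
    (exp (θ * I) * exp (-(μ * I))).re = Real.cos (θ - μ) := by
  rw [← exp_add, show (θ : ℂ) * I + -(μ * I) = ((θ - μ : ℝ) : ℂ) * I by push_cast; ring,
    exp_ofReal_mul_I_re]

/-- A real-affine function on the plane, zero on the line through the points of the unit circle of
arguments `α` and `β`. -/
noncomputable def chordFunctional (α β : ℝ) (z : ℂ) : ℝ :=
  (z * Complex.exp (-(((α + β) / 2 : ℝ) * Complex.I))).re - Real.cos ((β - α) / 2)

/-- The difference of cosines becomes a product of sines, from which the side of the line is read
off. -/
theorem chordFunctional_exp (α β θ : ℝ) : chordFunctional α β (Complex.exp (θ * Complex.I)) =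
    2 * Real.sin ((θ - α) / 2) * Real.sin ((β - θ) / 2) := by
  unfold chordFunctional
  rw [re_exp_mul_exp_neg, Real.cos_sub_cos,
    show (θ - (α + β) / 2 + (β - α) / 2) / 2 = (θ - α) / 2 by ring,
    show (θ - (α + β) / 2 - (β - α) / 2) / 2 = -((β - θ) / 2) by ring, Real.sin_neg]
  ring

theorem chordFunctional_add_smul (α β : ℝ) {s t : ℝ} (h : s + t = 1) (z w : ℂ) :
    chordFunctional α β (s • z + t • w) = s * chordFunctional α β z + t * chordFunctional α β w := by
  unfold chordFunctional
  rw [add_mul, smul_mul_assoc, smul_mul_assoc, Complex.add_re, Complex.smul_re, Complex.smul_re,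
    smul_eq_mul, smul_eq_mul, ← eq_sub_iff_add_eq'] at *
  subst h
  ring

/-- The point of argument `θ` on the unit circle. -/
noncomputable abbrev circleExp (θ : ℝ) : ℂ := Complex.exp (θ * Complex.I)

section Chords

variable {α β γ δ : ℝ}

theorem chordFunctional_left : chordFunctional α β (circleExp α) = 0 := by
  rw [chordFunctional_exp]
  simp

theorem chordFunctional_right : chordFunctional α β (circleExp β) = 0 := by
  rw [chordFunctional_exp]
  simp

theorem chordFunctional_pos {θ : ℝ} (hα : 0 < α) (hβ : β ≤ 2 * Real.pi) (h1 : α < θ) (h2 : θ < β) :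
    0 < chordFunctional α β (circleExp θ) := by
  rw [chordFunctional_exp]
  have a1 := Real.sin_pos_of_pos_of_lt_pi (x := (θ - α) / 2) (by linarith) (by linarith)
  have a2 := Real.sin_pos_of_pos_of_lt_pi (x := (β - θ) / 2) (by linarith) (by linarith)
  positivity

theorem chordFunctional_neg_of_lt {θ : ℝ} (hθ : 0 < θ) (hβ : β ≤ 2 * Real.pi) (h1 : θ < α)
    (h2 : α < β) : chordFunctional α β (circleExp θ) < 0 := by
  rw [chordFunctional_exp]
  have a1 := Real.sin_pos_of_pos_of_lt_pi (x := (α - θ) / 2) (by linarith) (by linarith)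
  have a2 := Real.sin_pos_of_pos_of_lt_pi (x := (β - θ) / 2) (by linarith) (by linarith)
  rw [show (θ - α) / 2 = -((α - θ) / 2) by ring, Real.sin_neg]
  nlinarith [mul_pos a1 a2]

theorem chordFunctional_neg_of_gt {θ : ℝ} (hα : 0 < α) (hθ : θ ≤ 2 * Real.pi) (h1 : α < β)
    (h2 : β < θ) : chordFunctional α β (circleExp θ) < 0 := by
  rw [chordFunctional_exp]
  have a1 := Real.sin_pos_of_pos_of_lt_pi (x := (θ - α) / 2) (by linarith) (by linarith)
  have a2 := Real.sin_pos_of_pos_of_lt_pi (x := (θ - β) / 2) (by linarith) (by linarith)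
  rw [show (β - θ) / 2 = -((θ - β) / 2) by ring, Real.sin_neg]
  nlinarith [mul_pos a1 a2]

/-- Two lines with directions that differ by an angle in `(0, π)` meet in at most one point. -/
theorem eq_of_chordFunctional_eq_zero (h1 : α < γ) (h2 : γ < β) (h3 : β < δ)
    (h4 : δ - α < 2 * Real.pi) {z w : ℂ}
    (hz : chordFunctional α β z = 0) (hw : chordFunctional α β w = 0)
    (hz' : chordFunctional γ δ z = 0) (hw' : chordFunctional γ δ w = 0) : z = w := by
  have expand : ∀ μ : ℝ, ∀ z : ℂ, (z * Complex.exp (-((μ : ℝ) * Complex.I))).re =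
      z.re * Real.cos μ + z.im * Real.sin μ := by
    intro μ z
    rw [show -((μ : ℂ) * Complex.I) = ((-μ : ℝ) : ℂ) * Complex.I by push_cast; ring,
      Complex.mul_re, Complex.exp_ofReal_mul_I_re, Complex.exp_ofReal_mul_I_im, Real.cos_neg,
      Real.sin_neg]
    ring
  unfold chordFunctional at hz hw hz' hw'
  rw [expand] at hz hw hz' hw'
  -- The normals have arguments `(α + β) / 2` and `(γ + δ) / 2`. The sine of their difference is the
  -- determinant of the system; `e1` and `e2` are Cramer's rule.
  have hs := Real.sin_pos_of_pos_of_lt_pi (x := (γ + δ) / 2 - (α + β) / 2) (by linarith)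
    (by linarith)
  rw [Real.sin_sub] at hs
  generalize (α + β) / 2 = μ at *
  generalize (γ + δ) / 2 = ν at *
  have e1 : (z.re - w.re) * (Real.sin ν * Real.cos μ - Real.cos ν * Real.sin μ) = 0 := by
    linear_combination Real.sin ν * (hz - hw) - Real.sin μ * (hz' - hw')
  have e2 : (z.im - w.im) * (Real.sin ν * Real.cos μ - Real.cos ν * Real.sin μ) = 0 := by
    linear_combination Real.cos μ * (hz' - hw') - Real.cos ν * (hz - hw)
  refine Complex.ext ?_ ?_
  · exact sub_eq_zero.1 ((mul_eq_zero.1 e1).resolve_right hs.ne')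
  · exact sub_eq_zero.1 ((mul_eq_zero.1 e2).resolve_right hs.ne')

theorem exists_mem_segment_chordFunctional_eq_zero {z w : ℂ}
    (h : chordFunctional α β z * chordFunctional α β w < 0) :
    ∃ u ∈ segment ℝ z w, chordFunctional α β u = 0 := by
  have hne : chordFunctional α β w - chordFunctional α β z ≠ 0 := by
    intro h0
    rw [sub_eq_zero.1 h0] at h
    nlinarith [mul_self_nonneg (chordFunctional α β z)]
  set a := chordFunctional α β z with ha
  set b := chordFunctional α β w with hb
  have hsum : b / (b - a) + (-a) / (b - a) = 1 := by
    field_simp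
    ring
  refine ⟨(b / (b - a)) • z + ((-a) / (b - a)) • w,
    ⟨_, _, ?_, ?_, hsum, rfl⟩, ?_⟩
  · rcases lt_or_gt_of_ne hne with h' | h'
    · exact div_nonneg_of_nonpos (by nlinarith) h'.le
    · exact div_nonneg (by nlinarith) h'.le
  · rcases lt_or_gt_of_ne hne with h' | h'
    · exact div_nonneg_of_nonpos (by nlinarith) h'.le
    · exact div_nonneg (by nlinarith) h'.le
  · rw [chordFunctional_add_smul _ _ hsum, ← ha, ← hb]
    field_simp
    ring

/-- Each segment meets the line of the other by a sign change. Both meeting points lie on both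
lines, hence coincide. -/
theorem segments_meet (h0 : 0 < α) (h1 : α < γ) (h2 : γ < β) (h3 : β < δ)
    (h4 : δ ≤ 2 * Real.pi) : (segment ℝ (circleExp α) (circleExp β) ∩
      segment ℝ (circleExp γ) (circleExp δ)).Nonempty := by
  obtain ⟨u, hu, hu'⟩ := exists_mem_segment_chordFunctional_eq_zero (α := α) (β := β)
    (z := circleExp γ) (w := circleExp δ) (mul_neg_of_pos_of_neg
      (chordFunctional_pos h0 (by linarith) h1 h2) (chordFunctional_neg_of_gt h0 h4 (by linarith) h3))
  obtain ⟨v, hv, hv'⟩ := exists_mem_segment_chordFunctional_eq_zero (α := γ) (β := δ)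
    (z := circleExp α) (w := circleExp β) (mul_neg_of_neg_of_pos
      (chordFunctional_neg_of_lt h0 h4 h1 (by linarith))
      (chordFunctional_pos (by linarith) h4 h2 h3))
  have hu2 : chordFunctional γ δ u = 0 := by
    obtain ⟨a, b, -, -, hab, rfl⟩ := hu
    rw [chordFunctional_add_smul _ _ hab, chordFunctional_left, chordFunctional_right]
    ring
  have hv2 : chordFunctional α β v = 0 := by
    obtain ⟨a, b, -, -, hab, rfl⟩ := hv
    rw [chordFunctional_add_smul _ _ hab, chordFunctional_left, chordFunctional_right]
    ring
  have : u = v := eq_of_chordFunctional_eq_zero h1 h2 h3 (by linarith) hu' hv2 hu2 hv'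
  exact ⟨u, this ▸ hv, hu⟩

/-- The functional vanishes on the first segment and keeps a strict sign on the second. -/
theorem segments_disjoint_of_sign {z w : ℂ}
    (h : 0 < chordFunctional α β z * chordFunctional α β w) :
    ¬ (segment ℝ (circleExp α) (circleExp β) ∩ segment ℝ z w).Nonempty := by
  rintro ⟨u, ⟨a, b, -, -, hab, rfl⟩, ⟨c, d, hc, hd, hcd, h'⟩⟩
  have k1 := chordFunctional_add_smul α β hab (circleExp α) (circleExp β)
  have k2 := chordFunctional_add_smul α β hcd z w
  rw [chordFunctional_left, chordFunctional_right] at k1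
  rw [h', k1] at k2
  rcases mul_pos_iff.1 h with ⟨h1, h2⟩ | ⟨h1, h2⟩
  · rcases hc.eq_or_lt with rfl | hc
    · nlinarith
    · nlinarith [mul_pos hc h1, mul_nonneg hd h2.le]
  · rcases hc.eq_or_lt with rfl | hc
    · nlinarith
    · nlinarith [mul_pos hc (neg_pos.2 h1), mul_nonneg hd (neg_pos.2 h2).le]

end Chords

/-! ### From segments to interleaving, and the number of chords. -/

namespace Matching

variable {n : ℕ}

/-- The argument of the point that carries the label of value `k`. -/
noncomputable def angle (n k : ℕ) : ℝ := Real.pi * (k + 1) / n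

theorem angle_pos (hn : 0 < n) (k : ℕ) : 0 < angle n k := by
  have := Real.pi_pos
  unfold angle
  positivity

theorem angle_lt (hn : 0 < n) {j k : ℕ} (h : j < k) : angle n j < angle n k := by
  have := Real.pi_pos
  have hn' : (0 : ℝ) < n := by exact_mod_cast hn
  have h' : (j : ℝ) < k := by exact_mod_cast h
  unfold angle
  gcongr

theorem angle_le (hn : 0 < n) {k : ℕ} (h : k < 2 * n) : angle n k ≤ 2 * Real.pi := by
  have := Real.pi_pos
  have hn' : (0 : ℝ) < n := by exact_mod_cast hn
  have h' : (k : ℝ) + 1 ≤ 2 * n := by exact_mod_cast h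
  unfold angle
  rw [div_le_iff₀ hn']
  nlinarith

theorem circlePoint_eq (i : Fin (2 * n)) : circlePoint n i = circleExp (angle n i) := by
  have hn : (n : ℂ) ≠ 0 := by
    have := i.isLt
    exact_mod_cast (by omega : n ≠ 0)
  unfold circlePoint circleExp angle
  rw [← Complex.exp_nat_mul]
  congr 1
  push_cast
  field_simp

theorem segments_meet_iff (hn : 0 < n) {a b c d : ℕ} (ha : a < 2 * n) (hb : b < 2 * n)
    (hc : c < 2 * n) (hd : d < 2 * n) (hab : a ≠ b) (hcd : c ≠ d) (hca : c ≠ a) (hcb : c ≠ b)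
    (hda : d ≠ a) (hdb : d ≠ b) :
    (segment ℝ (circleExp (angle n a)) (circleExp (angle n b)) ∩
      segment ℝ (circleExp (angle n c)) (circleExp (angle n d))).Nonempty ↔
      ¬ (StrictlyBetween a b c ↔ StrictlyBetween a b d) := by
  wlog hab' : a < b generalizing a b
  · rw [segment_symm, strictlyBetween_comm a b, strictlyBetween_comm a b]
    exact this hb ha hab.symm hcb hca hdb hda (by omega)
  wlog hcd' : c < d generalizing c d
  · rw [segment_symm ℝ (circleExp (angle n c)), iff_comm (a := StrictlyBetween a b c)]
    exact this hd hc hcd.symm hda hdb hca hcb (by omega)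
  have pos : ∀ k, StrictlyBetween a b k →
      0 < chordFunctional (angle n a) (angle n b) (circleExp (angle n k)) := by
    intro k hk
    refine chordFunctional_pos (angle_pos hn a) (angle_le hn hb) (angle_lt hn ?_) (angle_lt hn ?_)
    all_goals
      unfold StrictlyBetween at hk
      omega
  have neg : ∀ k < 2 * n, k ≠ a → k ≠ b → ¬ StrictlyBetween a b k →
      chordFunctional (angle n a) (angle n b) (circleExp (angle n k)) < 0 := by
    intro k hk h1 h2 h3
    unfold StrictlyBetween at h3
    rcases lt_or_gt_of_ne h1 with h | h
    · exact chordFunctional_neg_of_lt (angle_pos hn k) (angle_le hn hb) (angle_lt hn h)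
        (angle_lt hn hab')
    · exact chordFunctional_neg_of_gt (angle_pos hn a) (angle_le hn hk) (angle_lt hn hab')
        (angle_lt hn (by omega))
  by_cases hC : StrictlyBetween a b c <;> by_cases hD : StrictlyBetween a b d
  · exact iff_of_false (segments_disjoint_of_sign (mul_pos (pos c hC) (pos d hD))) (by tauto)
  · refine iff_of_true ?_ (by tauto)
    unfold StrictlyBetween at hC hD
    exact segments_meet (angle_pos hn a) (angle_lt hn (by omega)) (angle_lt hn (by omega))
      (angle_lt hn (by omega)) (angle_le hn hd)
  · refine iff_of_true ?_ (by tauto)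
    unfold StrictlyBetween at hC hD
    rw [Set.inter_comm]
    exact segments_meet (angle_pos hn c) (angle_lt hn (by omega)) (angle_lt hn (by omega))
      (angle_lt hn (by omega)) (angle_le hn hb)
  · exact iff_of_false (segments_disjoint_of_sign (mul_pos_of_neg_of_neg (neg c hc hca hcb hC)
      (neg d hd hda hdb hD))) (by tauto)

variable (m : Matching n)

/-- The chord at a position. -/
def chordAt (x : Fin (2 * n)) : {c // c ∈ m.chords} :=
  ⟨{x, m.toFun x}, Finset.mem_image.2 ⟨x, Finset.mem_univ x, rfl⟩⟩

theorem chordAt_surjective : Function.Surjective m.chordAt := by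
  rintro ⟨c, hc⟩
  obtain ⟨x, -, rfl⟩ := Finset.mem_image.1 hc
  exact ⟨x, rfl⟩

theorem chordAt_toFun (x : Fin (2 * n)) : m.chordAt (m.toFun x) = m.chordAt x := by
  unfold chordAt
  simp only [toFun_toFun, Finset.pair_comm]

theorem chordAt_eq_iff (x y : Fin (2 * n)) : m.chordAt y = m.chordAt x ↔ y = x ∨ y = m.toFun x := by
  constructor
  · intro h
    have h' : y ∈ (m.chordAt x).1 := by
      rw [← h]
      simp [chordAt]
    simpa [chordAt] using h'
  · rintro (rfl | rfl)
    · rfl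
    · exact m.chordAt_toFun x

theorem chordSegment_chordAt (x : Fin (2 * n)) : chordSegment n (m.chordAt x).1 =
    segment ℝ (circleExp (angle n x)) (circleExp (angle n (m.toFun x))) := by
  unfold chordSegment chordAt
  rw [Finset.coe_pair, Set.image_pair, convexHull_pair, circlePoint_eq, circlePoint_eq]

theorem graph_adj_iff (x y : Fin (2 * n)) :
    m.graph.Adj (m.chordAt x) (m.chordAt y) ↔ m.Crosses x y := by
  by_cases h : y = x ∨ y = m.toFun x
  · refine iff_of_false (fun hadj => hadj.ne ((m.chordAt_eq_iff x y).2 h).symm) fun hc => ?_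
    exact h.elim hc.ne.1 hc.ne.2
  · have h' : m.chordAt x ≠ m.chordAt y := fun e => h ((m.chordAt_eq_iff x y).1 e.symm)
    push Not at h
    have hv := m.val_ne_of_ne h.1 h.2
    have hx := x.isLt
    have key := segments_meet_iff (n := n) (by omega) x.isLt (m.toFun x).isLt y.isLt
      (m.toFun y).isLt (m.toFun_val_ne x).symm (m.toFun_val_ne y).symm hv.1 hv.2.1 hv.2.2.1
      hv.2.2.2
    rw [← chordSegment_chordAt, ← chordSegment_chordAt] at key
    unfold Crosses
    rw [← key]
    exact and_iff_right h'

theorem card_chords : m.chords.card = n := by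
  have h := Finset.card_eq_sum_card_image (fun x => ({x, m.toFun x} : Finset (Fin (2 * n))))
    Finset.univ
  have h2 : ∀ c ∈ m.chords, (Finset.univ.filter fun x : Fin (2 * n) =>
      ({x, m.toFun x} : Finset (Fin (2 * n))) = c).card = 2 := by
    intro c hc
    obtain ⟨x, hx⟩ := m.chordAt_surjective ⟨c, hc⟩
    have e : (Finset.univ.filter fun y : Fin (2 * n) =>
        ({y, m.toFun y} : Finset (Fin (2 * n))) = c) = {x, m.toFun x} := by
      ext y
      have := m.chordAt_eq_iff x y
      rw [hx, Subtype.ext_iff] at this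
      simpa [chordAt] using this
    rw [e, Finset.card_pair (m.fixedPointFree x).symm]
  change _ = ∑ c ∈ m.chords, _ at h
  rw [Finset.sum_congr rfl h2, Finset.sum_const, Finset.card_univ, Fintype.card_fin,
    smul_eq_mul] at h
  omega

end Matching

/-! ### From a split to a decomposition. -/

namespace Matching

section ToDecomposition

variable {n : ℕ}

theorem blockIndex_le_ncard_boundary [NeZero n] (S : Set (Fin (2 * n))) (x : Fin (2 * n)) :
    blockIndex S x ≤ (boundary S).ncard := by
  classical
  unfold blockIndex
  rw [Nat.count_eq_card_filter_range, ← Set.ncard_image_of_injective (boundary S) Fin.val_injective,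
    ← Set.ncard_coe_finset]
  refine Set.ncard_le_ncard ?_ (Set.toFinite _)
  intro k hk
  simp only [Finset.coe_filter, Finset.mem_range, Set.mem_ofPred_eq] at hk
  have hx := x.isLt
  refine ⟨⟨k, by omega⟩, ?_, rfl⟩
  intro h
  refine hk.2 ?_
  rcases val_add_one_cases (⟨k, by omega⟩ : Fin (2 * n)) with h' | h'
  · rw [← val_mem_image_iff, ← val_mem_image_iff, h'.2] at h
    exact h
  · simp only at h'
    omega

theorem isCircularInterval_of_iff {N : ℕ} {C : Finset (Fin N)} (a b : ℕ)
    (h : ∀ x : Fin N, x ∈ C ↔ a ≤ (x : ℕ) ∧ (x : ℕ) < b) : IsCircularInterval C := by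
  refine ⟨a, min b N - a, fun x => ?_⟩
  have hx := x.isLt
  rw [h x]
  constructor
  · intro h'
    refine ⟨x - a, by omega, ?_⟩
    rw [Nat.add_sub_cancel' h'.1, Nat.mod_eq_of_lt hx]
  · rintro ⟨j, hj, hxj⟩
    rw [Nat.mod_eq_of_lt (by omega)] at hxj
    omega

theorem isCircularInterval_of_iff_not {N : ℕ} {C : Finset (Fin N)} (a b : ℕ) (hab : a ≤ b)
    (h : ∀ x : Fin N, x ∈ C ↔ ¬ (a ≤ (x : ℕ) ∧ (x : ℕ) < b)) : IsCircularInterval C := by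
  by_cases hb : b ≤ N
  · refine ⟨b, N - b + a, fun x => ?_⟩
    have hx := x.isLt
    rw [h x]
    constructor
    · intro h'
      by_cases hxa : (x : ℕ) < a
      · refine ⟨x + (N - b), by omega, ?_⟩
        rw [show b + (x + (N - b)) = x + N by omega, Nat.add_mod_right, Nat.mod_eq_of_lt hx]
      · refine ⟨x - b, by omega, ?_⟩
        rw [Nat.add_sub_cancel' (by omega), Nat.mod_eq_of_lt hx]
    · rintro ⟨j, hj, hxj⟩
      by_cases hjN : b + j < N
      · rw [Nat.mod_eq_of_lt hjN] at hxj
        omega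
      · rw [Nat.mod_eq_sub_mod (by omega), Nat.mod_eq_of_lt (by omega)] at hxj
        omega
  · refine isCircularInterval_of_iff 0 a fun x => ?_
    rw [h x]
    omega

theorem two_le_card_filter {m : Matching n} {T : Set (Fin (2 * n))} (hT : m.HasTwoChords T)
    {p : Finset (Fin (2 * n)) → Prop} [DecidablePred p] (hp : ∀ x ∈ T, p (m.chordAt x).1) :
    2 ≤ (m.chords.filter p).card := by
  obtain ⟨x, hx, y, hy, h1, h2⟩ := hT
  refine Finset.one_lt_card.2 ⟨_, Finset.mem_filter.2 ⟨(m.chordAt x).2, hp x hx⟩, _,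
    Finset.mem_filter.2 ⟨(m.chordAt y).2, hp y hy⟩, fun h => ?_⟩
  rcases (m.chordAt_eq_iff x y).1 (Subtype.ext h.symm) with h | h
  exacts [h1 h, h2 h]

theorem IsBlockDecomposable.isDecomposable [NeZero n] {m : Matching n}
    (h : m.IsBlockDecomposable) : m.IsDecomposable := by
  obtain ⟨S, hS, h2, h3, hb⟩ := h
  have hle : ∀ x : Fin (2 * n), blockIndex S x ≤ 4 := fun x =>
    (blockIndex_le_ncard_boundary S x).trans hb
  have hpar := fun x => (mem_iff_mem_iff_blockIndex S _ _).1 (hS x)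
  -- With at most four changes the index is at most 4; reduction modulo 4 joins block 4 to block 0
  -- across the seam.
  set C : Fin 4 → Finset (Fin (2 * n)) := fun i =>
    Finset.univ.filter fun x => blockIndex S x % 4 = i with hC
  have mem : ∀ i x, x ∈ C i ↔ blockIndex S x % 4 = i := fun i x => by simp [hC]
  have mem02 : ∀ x, x ∈ C 0 ∪ C 2 ↔ blockIndex S x % 2 = 0 := fun x => by
    rw [Finset.mem_union, mem, mem]
    simp only [Fin.val_zero, Fin.val_two]
    omega
  have mem13 : ∀ x, x ∈ C 1 ∪ C 3 ↔ blockIndex S x % 2 = 1 := fun x => by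
    rw [Finset.mem_union, mem, mem, show ((3 : Fin 4) : ℕ) = 3 from rfl]
    simp only [Fin.val_one]
    omega
  have sub02 : ∀ x : Fin (2 * n), blockIndex S x % 2 = 0 → (m.chordAt x).1 ⊆ C 0 ∪ C 2 := by
    intro x hx y hy
    rw [mem02]
    have := hpar x
    simp only [chordAt, Finset.mem_insert, Finset.mem_singleton] at hy
    rcases hy with rfl | rfl <;> omega
  have sub13 : ∀ x : Fin (2 * n), blockIndex S x % 2 = 1 → (m.chordAt x).1 ⊆ C 1 ∪ C 3 := by
    intro x hx y hy
    rw [mem13]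
    have := hpar x
    simp only [chordAt, Finset.mem_insert, Finset.mem_singleton] at hy
    rcases hy with rfl | rfl <;> omega
  -- `T` is whichever of `S` and `Sᶜ` omits position 0, i.e. the odd blocks.
  obtain ⟨T, hT2, hT3, hT⟩ : ∃ T : Set (Fin (2 * n)), m.HasTwoChords T ∧ m.HasTwoChords Tᶜ ∧
      ∀ x, x ∈ T ↔ blockIndex S x % 2 = 1 := by
    have e : ∀ x : Fin (2 * n), (x ∈ S ↔ (0 : Fin (2 * n)) ∈ S) ↔ blockIndex S x % 2 = 0 := by
      intro x
      rw [mem_iff_mem_iff_blockIndex, val_zero_eq, blockIndex_zero]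
    by_cases h0 : (0 : Fin (2 * n)) ∈ S
    · refine ⟨Sᶜ, h3, by rwa [compl_compl], fun x => ?_⟩
      have := e x
      rw [iff_true_right h0] at this
      rw [Set.mem_compl_iff, this]
      omega
    · refine ⟨S, h2, h3, fun x => ?_⟩
      have := e x
      rw [iff_false_right h0] at this
      rw [← not_iff_not, this]
      omega
  refine ⟨(m.chords.filter fun c => c ⊆ C 1 ∪ C 3).card, ?_, ?_, C, ?_, ?_, ?_, ?_, ?_, rfl⟩
  · exact two_le_card_filter hT2 fun x hx => sub13 x ((hT x).1 hx)
  · have k1 : 2 ≤ (m.chords.filter fun c => ¬ c ⊆ C 1 ∪ C 3).card := by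
      refine two_le_card_filter hT3 fun x hx hsub => hx ((hT x).2 ((mem13 x).1 (hsub ?_)))
      simp [chordAt]
    have k2 := Finset.card_filter_add_card_filter_not (s := m.chords) fun c => c ⊆ C 1 ∪ C 3
    rw [card_chords] at k2
    omega
  · intro x
    refine ⟨⟨blockIndex S x % 4, Nat.mod_lt _ (by norm_num)⟩, (mem _ _).2 rfl, fun i hi => ?_⟩
    exact Fin.ext ((mem _ _).1 hi).symm
  · intro i
    obtain rfl | hi := eq_or_ne i 0
    · obtain ⟨a, ha⟩ := exists_threshold (p := fun x => blockIndex S x < 1)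
        (fun x y h hy => (blockIndex_mono S h).trans_lt hy) (2 * n)
      obtain ⟨b, hb⟩ := exists_threshold (p := fun x => blockIndex S x < 4)
        (fun x y h hy => (blockIndex_mono S h).trans_lt hy) (2 * n)
      refine isCircularInterval_of_iff_not a (max a b) (le_max_left _ _) fun x => ?_
      have k1 := ha x x.isLt
      have k2 := hb x x.isLt
      have k3 := hle x
      rw [mem, Fin.val_zero]
      omega
    · obtain ⟨a, b, hab⟩ := exists_interval_of_monotone (blockIndex_mono S) i (2 * n)
      refine isCircularInterval_of_iff a b fun x => ?_
      rw [mem, ← hab x x.isLt]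
      have k3 := hle x
      have k4 := Fin.pos_iff_ne_zero.2 hi
      rw [Fin.lt_def, Fin.val_zero] at k4
      omega
  · exact ⟨0, (mem _ _).2 (by rw [val_zero_eq, blockIndex_zero]; rfl), rfl⟩
  · intro i j hi hij hi' hj'
    have k1 := (mem _ _).1 (Finset.min'_mem _ hi')
    have k2 := (mem _ _).1 (Finset.min'_mem _ hj')
    have k3 := hle ((C i).min' hi')
    have k4 := hle ((C j).min' hj')
    rw [Fin.lt_def] at hi hij ⊢
    rw [Fin.val_zero] at hi
    exact lt_of_blockIndex_lt S (by omega)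
  · intro c hc
    obtain ⟨x, hx⟩ := m.chordAt_surjective ⟨c, hc⟩
    have hx' : (m.chordAt x).1 = c := by rw [hx]
    rw [← hx']
    rcases Nat.mod_two_eq_zero_or_one (blockIndex S x) with h | h
    · exact Or.inl (sub02 x h)
    · exact Or.inr (sub13 x h)

theorem exists_two_of_encard_ne_one {X : Type*} {V : Set X} (h : V.Nonempty) (h' : V.encard ≠ 1) :
    ∃ x ∈ V, ∃ y ∈ V, x ≠ y := by
  rcases h.exists_eq_singleton_or_nontrivial with ⟨a, rfl⟩ | ⟨x, hx, y, hy, hne⟩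
  · exact absurd (Set.encard_singleton a) h'
  · exact ⟨x, hx, y, hy, hne⟩

/-- A nontrivial split of the graph of a matching yields a decomposition of the matching. -/
theorem isDecomposable_of_isSplit {m : Matching n} {V₁ V₂ : Set {c // c ∈ m.chords}}
    (h : m.graph.IsSplit V₁ V₂) (h1 : V₁.encard ≠ 1) (h2 : V₂.encard ≠ 1) :
    m.IsDecomposable := by
  obtain ⟨⟨hne1, hne2, hdisj, huniv⟩, A, -, B, -, hAB⟩ := h
  obtain ⟨v, -⟩ := id hne1
  obtain ⟨x₀, -⟩ := m.chordAt_surjective v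
  have : NeZero n := ⟨by have := x₀.isLt; omega⟩
  have hV2 : ∀ x, x ∉ m.chordAt ⁻¹' V₁ ↔ m.chordAt x ∈ V₂ := by
    intro x
    have hx : m.chordAt x ∈ V₁ ∪ V₂ := huniv ▸ Set.mem_univ _
    exact ⟨fun h => hx.resolve_left h, fun h h' => Set.disjoint_left.1 hdisj h' h⟩
  have two : ∀ V : Set {c // c ∈ m.chords}, V.Nonempty → V.encard ≠ 1 →
      m.HasTwoChords (m.chordAt ⁻¹' V) := by
    intro V hV hV'
    obtain ⟨c, hc, d, hd, hcd⟩ := exists_two_of_encard_ne_one hV hV'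
    obtain ⟨x, rfl⟩ := m.chordAt_surjective c
    obtain ⟨y, rfl⟩ := m.chordAt_surjective d
    have hxy := mt (m.chordAt_eq_iff x y).2 hcd.symm
    push Not at hxy
    exact ⟨x, hc, y, hd, hxy.1, hxy.2⟩
  refine IsBlockDecomposable.isDecomposable (isBlockDecomposable_of_isRankOne
    (S := m.chordAt ⁻¹' V₁) ?_ ?_ (two V₁ hne1 h1) ((two V₂ hne2 h2).mono fun x hx => (hV2 x).2 hx))
  · intro x
    rw [Set.mem_preimage, Set.mem_preimage, chordAt_toFun]
  · intro x hx x' hx' y hy y' hy' hc hc'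
    rw [← graph_adj_iff] at hc hc' ⊢
    rw [hV2] at hy hy'
    rw [hAB _ hx _ hy] at hc
    rw [hAB _ hx' _ hy'] at hc'
    rw [hAB _ hx _ hy']
    exact ⟨hc.1, hc'.2⟩

end ToDecomposition

end Matching

/-! ### From a decomposition to a split. -/

namespace Matching

section ToSplit

variable {n : ℕ}

theorem IsCircularInterval.exists_lt {N : ℕ} {C : Finset (Fin N)} (h : IsCircularInterval C)
    (hN : 0 < N) : ∃ a l : ℕ, a < N ∧ ∀ x : Fin N, x ∈ C ↔ ∃ j < l, (x : ℕ) = (a + j) % N := by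
  obtain ⟨a, l, h⟩ := h
  refine ⟨a % N, l, Nat.mod_lt _ hN, fun x => ?_⟩
  simp only [h x, Nat.mod_add_mod]

/-- A run that avoids 0 never wraps around. -/
theorem IsCircularInterval.convex {N : ℕ} {C : Finset (Fin N)} (h : IsCircularInterval C)
    (h0 : ∀ x ∈ C, (x : ℕ) ≠ 0) {x y z : Fin N} (hx : x ∈ C) (hz : z ∈ C) (hxy : x ≤ y)
    (hyz : y ≤ z) : y ∈ C := by
  have hN : 0 < N := x.pos
  obtain ⟨a, l, ha, h⟩ := h.exists_lt hN
  have small : ∀ j < l, a + j < N := by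
    intro j hj
    by_contra hc
    refine h0 ⟨0, hN⟩ ((h _).2 ⟨N - a, by omega, ?_⟩) rfl
    simp only
    rw [Nat.add_sub_cancel' ha.le, Nat.mod_self]
  obtain ⟨j, hj, hxj⟩ := (h x).1 hx
  obtain ⟨k, hk, hzk⟩ := (h z).1 hz
  rw [Nat.mod_eq_of_lt (small _ hj)] at hxj
  rw [Nat.mod_eq_of_lt (small _ hk)] at hzk
  rw [Fin.le_def] at hxy hyz
  refine (h y).2 ⟨y - a, by omega, ?_⟩
  rw [Nat.add_sub_cancel' (by omega), Nat.mod_eq_of_lt y.isLt]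

theorem IsCircularInterval.compl_convex {N : ℕ} {C : Finset (Fin N)} (h : IsCircularInterval C)
    (h0 : ∃ x ∈ C, (x : ℕ) = 0) {x y z : Fin N} (hx : x ∉ C) (hz : z ∉ C) (hxy : x ≤ y)
    (hyz : y ≤ z) : y ∉ C := by
  intro hy
  obtain ⟨o, ho, ho0⟩ := h0
  obtain ⟨a, l, ha, h⟩ := h.exists_lt x.pos
  obtain ⟨j, hj, hyj⟩ := (h y).1 hy
  obtain ⟨k, hk, hok⟩ := (h o).1 ho
  rw [Fin.le_def] at hxy hyz
  have hzN := z.isLt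
  -- If the run starts at 0 or reaches `y` after wrapping, it has already passed `x`. Otherwise it
  -- must go on from `y` past `z` in order to reach 0.
  by_cases hw : a = 0 ∨ N ≤ a + j
  · have hdiv := Nat.div_add_mod (a + j) N
    rw [← hyj] at hdiv
    have hyle : (y : ℕ) ≤ j := by
      rcases hw with rfl | hw
      · omega
      · have : N * 1 ≤ N * ((a + j) / N) :=
          Nat.mul_le_mul_left _ ((Nat.one_le_div_iff x.pos).2 hw)
        omega
    refine hx ((h x).2 ⟨j - (y - x), by omega, ?_⟩)
    rw [show a + (j - (y - x)) = x + N * ((a + j) / N) by omega, Nat.add_mul_mod_self_left,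
      Nat.mod_eq_of_lt x.isLt]
  · push Not at hw
    rw [Nat.mod_eq_of_lt hw.2] at hyj
    have hkN : N ≤ a + k := by
      by_contra hc
      rw [Nat.mod_eq_of_lt (by omega)] at hok
      omega
    refine hz ((h z).2 ⟨z - a, by omega, ?_⟩)
    rw [Nat.add_sub_cancel' (by omega), Nat.mod_eq_of_lt z.isLt]

/-- Used with `p`, `p'` for membership of `x`, `x'` in `C 0` and `q`, `q'` for that of `y`, `y'` in
`C 1`. A point of `C 0` is never between `y` and `y'`; a point of `C 2` has `C 1` below it and `C 3`
above. -/
theorem interleave_iff {x x' y y' : ℕ} {p p' q q' : Prop} (hyx : y ≠ x) (hyx' : y ≠ x')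
    (hy'x : y' ≠ x) (hy'x' : y' ≠ x')
    (hp : p → ¬ (y < x ∧ x < y') ∧ ¬ (y' < x ∧ x < y))
    (hp' : p' → ¬ (y < x' ∧ x' < y') ∧ ¬ (y' < x' ∧ x' < y))
    (h1 : ¬ p → (q ↔ y < x)) (h2 : ¬ p → (q' ↔ y' < x))
    (h3 : ¬ p' → (q ↔ y < x')) (h4 : ¬ p' → (q' ↔ y' < x')) :
    ¬ (StrictlyBetween x x' y ↔ StrictlyBetween x x' y') ↔ ¬ (p ↔ p') ∧ ¬ (q ↔ q') := by
  unfold StrictlyBetween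
  by_cases a1 : p <;> by_cases a2 : p' <;> by_cases a3 : q <;> by_cases a4 : q' <;>
  simp only [a1, a2, a3, a4, true_iff, false_iff, forall_const, not_true_eq_false,
    not_false_eq_true, iff_self, false_imp_iff, and_false, and_true, iff_true, iff_false,
    not_not] at * <;> omega

/-- A decomposition of a matching yields a nontrivial split of its graph. -/
theorem IsDecomposable.exists_isSplit {m : Matching n} (h : m.IsDecomposable) :
    ∃ V₁ V₂, m.graph.IsSplit V₁ V₂ ∧ V₁.encard ≠ 1 ∧ V₂.encard ≠ 1 := by
  obtain ⟨k, hk, hkn, C, hpart, hint, hzero, hmin, hchord, hcard⟩ := h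
  have huniq : ∀ {i j x}, x ∈ C i → x ∈ C j → i = j := fun hi hj => (hpart _).unique hi hj
  have hpos : ∀ i, 0 < i → ∀ x ∈ C i, (x : ℕ) ≠ 0 := by
    intro i hi x hx h0
    obtain ⟨o, ho, ho0⟩ := hzero
    have : o = x := Fin.ext (by omega)
    subst this
    exact hi.ne (huniq ho hx)
  -- Parts other than `C 0` avoid position 0, so they are linear intervals, and the order of their
  -- minima orders them entirely.
  have hlt : ∀ i j, 0 < i → i < j → ∀ x ∈ C i, ∀ y ∈ C j, x < y := by
    intro i j hi hij x hx y hy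
    by_contra hc
    have hne : ∀ z ∈ C i, z ∉ C j := fun z hz hz' => hij.ne (huniq hz hz')
    have hm := hmin i j hi hij ⟨x, hx⟩ ⟨y, hy⟩
    refine hne y ?_ hy
    exact (hint i).convex (hpos i hi) (Finset.min'_mem _ ⟨x, hx⟩) hx
      (hm.le.trans (Finset.min'_le _ _ hy)) (not_lt.1 hc)
  have hall : ∀ x, x ∈ C 0 ∨ x ∈ C 1 ∨ x ∈ C 2 ∨ x ∈ C 3 := by
    intro x
    obtain ⟨i, hi, -⟩ := hpart x
    fin_cases i
    exacts [Or.inl hi, Or.inr (Or.inl hi), Or.inr (Or.inr (Or.inl hi)),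
      Or.inr (Or.inr (Or.inr hi))]
  have hdisj : ∀ x, x ∈ C 0 ∪ C 2 → x ∉ C 1 ∪ C 3 := by
    intro x h1 h2
    rw [Finset.mem_union] at h1 h2
    rcases h1 with h1 | h1 <;> rcases h2 with h2 | h2 <;>
    exact absurd (huniq h1 h2) (by decide)
  have hmemc : ∀ x, x ∈ (m.chordAt x).1 ∧ m.toFun x ∈ (m.chordAt x).1 := fun x => by
    simp [chordAt]
  have hcross : ∀ x y, (m.chordAt x).1 ⊆ C 0 ∪ C 2 → (m.chordAt y).1 ⊆ C 1 ∪ C 3 →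
      (m.Crosses x y ↔ ¬ (x ∈ C 0 ↔ m.toFun x ∈ C 0) ∧ ¬ (y ∈ C 1 ↔ m.toFun y ∈ C 1)) := by
    intro x y hx hy
    have ne : ∀ u v, u ∈ C 0 ∪ C 2 → v ∈ C 1 ∪ C 3 → (v : ℕ) ≠ u := by
      intro u v hu hv huv
      exact hdisj u hu (Fin.ext huv ▸ hv)
    have hsep : ∀ u v w, u ∈ C 0 → v ∈ C 1 ∪ C 3 → w ∈ C 1 ∪ C 3 →
        ¬ ((v : ℕ) < u ∧ (u : ℕ) < w) := by
      intro u v w hu hv hw huv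
      have out : ∀ v, v ∈ C 1 ∪ C 3 → v ∉ C 0 := fun v hv hv0 =>
        hdisj v (Finset.mem_union_left _ hv0) hv
      exact (hint 0).compl_convex hzero (out v hv) (out w hw) (Fin.le_def.2 huv.1.le)
        (Fin.le_def.2 huv.2.le) hu
    have hside : ∀ u v, u ∈ C 0 ∪ C 2 → v ∈ C 1 ∪ C 3 → u ∉ C 0 → (v ∈ C 1 ↔ (v : ℕ) < u) := by
      intro u v hu hv hu0
      have hu2 := (Finset.mem_union.1 hu).resolve_left hu0
      rcases Finset.mem_union.1 hv with hv | hv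
      · exact iff_of_true hv (hlt 1 2 (by decide) (by decide) v hv u hu2)
      · refine iff_of_false (fun hv1 => absurd (huniq hv hv1) (by decide)) ?_
        have := hlt 2 3 (by decide) (by decide) u hu2 v hv
        rw [Fin.lt_def] at this
        omega
    obtain ⟨hx1, hx2⟩ := hmemc x
    obtain ⟨hy1, hy2⟩ := hmemc y
    replace hx1 := hx hx1
    replace hx2 := hx hx2
    replace hy1 := hy hy1
    replace hy2 := hy hy2
    exact interleave_iff (ne _ _ hx1 hy1) (ne _ _ hx2 hy1) (ne _ _ hx1 hy2) (ne _ _ hx2 hy2)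
      (fun h => ⟨hsep _ _ _ h hy1 hy2, hsep _ _ _ h hy2 hy1⟩)
      (fun h => ⟨hsep _ _ _ h hy1 hy2, hsep _ _ _ h hy2 hy1⟩)
      (hside _ _ hx1 hy1) (hside _ _ hx1 hy2) (hside _ _ hx2 hy1) (hside _ _ hx2 hy2)
  have meets : ∀ (D : Finset (Fin (2 * n))) x, ((∃ u ∈ (m.chordAt x).1, u ∈ D) ∧
      (∃ u ∈ (m.chordAt x).1, u ∉ D)) ↔ ¬ (x ∈ D ↔ m.toFun x ∈ D) := by
    intro D x
    simp only [chordAt, Finset.mem_insert, Finset.mem_singleton, exists_eq_or_imp,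
      exists_eq_left]
    tauto
  have two : ∀ p : Finset (Fin (2 * n)) → Prop, ∀ _ : DecidablePred p,
      2 ≤ (m.chords.filter p).card →
      ({c : {c // c ∈ m.chords} | p c.1} : Set _).Nontrivial := by
    intro p _ hp
    obtain ⟨c, hc, d, hd, hcd⟩ := Finset.one_lt_card.1 hp
    rw [Finset.mem_filter] at hc hd
    exact ⟨⟨c, hc.1⟩, hc.2, ⟨d, hd.1⟩, hd.2, fun h => hcd (congrArg Subtype.val h)⟩
  have excl : ∀ c ∈ m.chords, c ⊆ C 0 ∪ C 2 → ¬ c ⊆ C 1 ∪ C 3 := by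
    intro c hc h1 h2
    obtain ⟨x, hx⟩ := m.chordAt_surjective ⟨c, hc⟩
    have hxc : x ∈ c := by
      have := (hmemc x).1
      rwa [hx] at this
    exact hdisj x (h1 hxc) (h2 hxc)
  have t2 := two (fun c => c ⊆ C 1 ∪ C 3) (fun _ => inferInstance) (by convert hk)
  have t1 := two (fun c => c ⊆ C 0 ∪ C 2) (fun _ => inferInstance) (by
    have e1 : (m.chords.filter fun c => ¬ c ⊆ C 1 ∪ C 3) =
        m.chords.filter fun c => c ⊆ C 0 ∪ C 2 := by
      refine Finset.filter_congr fun c hc => ?_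
      exact ⟨(hchord c hc).resolve_right, excl c hc⟩
    have e2 := Finset.card_filter_add_card_filter_not (s := m.chords) fun c => c ⊆ C 1 ∪ C 3
    rw [card_chords, e1, hcard] at e2
    omega)
  have enc : ∀ V : Set {c // c ∈ m.chords}, V.Nontrivial → V.encard ≠ 1 := by
    intro V hV h
    obtain ⟨x, rfl⟩ := Set.encard_eq_one.1 h
    exact Set.not_nontrivial_singleton hV
  -- The bipartite sides are the chords from `C 0` to `C 2` and those from `C 1` to `C 3`.
  refine ⟨_, _, ⟨⟨t1.nonempty, t2.nonempty, ?_, ?_⟩, {c | c.1 ⊆ C 0 ∪ C 2 ∧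
    ((∃ u ∈ c.1, u ∈ C 0) ∧ ∃ u ∈ c.1, u ∉ C 0)}, fun c hc => hc.1, {c | c.1 ⊆ C 1 ∪ C 3 ∧
    ((∃ u ∈ c.1, u ∈ C 1) ∧ ∃ u ∈ c.1, u ∉ C 1)}, fun c hc => hc.1, ?_⟩, enc _ t1, enc _ t2⟩
  · rw [Set.disjoint_left]
    exact fun c hc hc' => excl c.1 c.2 hc hc'
  · exact Set.eq_univ_of_forall fun c => hchord c.1 c.2
  · intro c hc d hd
    obtain ⟨x, rfl⟩ := m.chordAt_surjective c
    obtain ⟨y, rfl⟩ := m.chordAt_surjective d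
    rw [graph_adj_iff, hcross x y hc hd, ← meets, ← meets]
    exact and_congr (and_iff_right hc).symm (and_iff_right hd).symm

theorem isSplitPrime_graph_iff (m : Matching n) : m.graph.IsSplitPrime ↔ m.IsIndecomposable := by
  constructor
  · intro h hd
    obtain ⟨V₁, V₂, hs, h1, h2⟩ := hd.exists_isSplit
    exact (h V₁ V₂ hs).elim h1 h2
  · intro h V₁ V₂ hs
    by_contra hc
    push Not at hc
    exact h (isDecomposable_of_isSplit hs hc.1 hc.2)

end ToSplit

end Matching

/-! ### Transport along graph isomorphisms. -/

theorem SimpleGraph.IsSplit.preimage {V W : Type*} {G : SimpleGraph V} {H : SimpleGraph W}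
    (e : W ≃ V) (he : ∀ x y, H.Adj x y ↔ G.Adj (e x) (e y)) {V₁ V₂ : Set V}
    (h : G.IsSplit V₁ V₂) : H.IsSplit (e ⁻¹' V₁) (e ⁻¹' V₂) := by
  obtain ⟨⟨h1, h2, h3, h4⟩, A, hA, B, hB, hAB⟩ := h
  refine ⟨⟨h1.preimage e.surjective, h2.preimage e.surjective, h3.preimage e, ?_⟩, e ⁻¹' A,
    Set.preimage_mono hA, e ⁻¹' B, Set.preimage_mono hB, fun x hx y hy => ?_⟩
  · rw [← Set.preimage_union, h4, Set.preimage_univ]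
  · rw [he, hAB _ hx _ hy]
    rfl

theorem SimpleGraph.IsSplitPrime.of_iso {V W : Type*} {G : SimpleGraph V} {H : SimpleGraph W}
    (e : G ≃g H) (h : H.IsSplitPrime) : G.IsSplitPrime := by
  intro V₁ V₂ hs
  have enc : ∀ U : Set V, (e.toEquiv.symm ⁻¹' U).encard = U.encard := fun U =>
    Set.encard_preimage_of_bijective e.toEquiv.symm.bijective U
  have := h _ _ (hs.preimage e.toEquiv.symm fun x y => (e.symm.map_adj_iff).symm)
  rwa [enc, enc] at this

theorem mainTheorem8 {V : Type*} (G : SimpleGraph V) (hG : IsCircleGraph G)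
    {n : ℕ} (m : Matching n) (hm : m.Represents G) :
    G.IsSplitPrime ↔ m.IsIndecomposable := by
  obtain ⟨e⟩ := hm
  rw [← m.isSplitPrime_graph_iff]
  exact ⟨SimpleGraph.IsSplitPrime.of_iso e.symm, SimpleGraph.IsSplitPrime.of_iso e⟩
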